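/- **Setting.** All fields have characteristic $0$. Let $(\mathbb F(x),\sigma)$ be a $\Pi\Sigma$-field extension of a difference field $(\mathbb F,\sigma)$ with one monomial: $\mathbb F(x)$ is a rational function field, $\sigma(x)/x\in\mathbb F^*$ or $\sigma(x)-x\in\mathbb F$, and $\mathrm{const}(\mathbb F(x),\sigma)=\mathrm{const}(\mathbb F,\sigma)=:\mathbb K$. A nonzero polynomial $h\in\mathbb F[x]$ has *period $0$* if $\sigma^n(h)/h\notin\mathbb F$ for all $n\ge 1$. An element of $\mathbb F(x)^*$ has *$x$-degree $\le d$* if all irreducible period $0$ factors of its numerator and denominator have degree $\le d$. Polynomials $f,g$ are *$\sigma$-equivalent* if $\sigma^k(f)/g\in\mathbb F$ for some $k\in\mathbb Z$. A *$(d,x)$-set* is a finite set of monic irreducible period $0$ polynomials of degree $>d$ that are pairwise not $\sigma$-equivalent; it is *$(d,b)$-complete* if every irreducible period $0$ factor of $b$ of degree $>d$ is $\sigma$-equivalent to one of its elements. An *$R\Pi\Sigma$-extension* of a difference ring $(A,\sigma)$ is a tower $A\langle t_1\rangle\dots\langle t_e\rangle$ with the same constants as $A$, where each step adjoins an $R$-monomial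 ($t_i^\nu=1$, $\nu>1$, $\sigma(t_i)/t_i$ a primitive $\nu$-th root of unity in the previous ring), a $\Pi$-monomial (Laurent polynomials, $\sigma(t_i)/t_i$ a unit of the previous ring) or a $\Sigma$-monomial (polynomials, $\sigma(t_i)-t_i$ in the previous ring). It is *simple* if $\sigma(t_i)/t_i=u\,t_1^{m_1}\cdots t_{i-1}^{m_{i-1}}$ with $u\in A^*$ for $R$- and $\Pi$-monomials $t_i$, where $m_j=0$ if $t_j$ is a $\Sigma$-monomial and where, if $t_i$ is an $R$-monomial, $u$ is a root of unity and $m_j=0$ unless $t_j$ is an $R$-monomial. For $f\in\mathbb F(x)\langle t_1\rangle\dots\langle t_e\rangle$ let $\mathrm{den}(f)$ be the monic least common multiple of the denominators of its coefficients with respect to the reduced power products in the $t_i$. A simple $R\Pi\Sigma$-extension of $\mathbb F(x)$ has *$x$-degree $\le d$* if the factor $u\in\mathbb F(x)^*$ has $x$-degree $\le d$ for each $\Pi$-monomial and $\mathrm{den}(\sigma(t_i)-t_i)$ has $x$-degree $\le d$ for each $\Sigma$-monomial $t_i$. Let $Q$ be a $(d,x)$-set and let $\mathbb S=\mathbb E[s_1,\dots,s_r]$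 be a *$(d,x,Q)$-reduced* $R\Pi\Sigma$-extension of $\mathbb F(x)$: $\mathbb E=\mathbb F(x)\langle t_1\rangle\dots\langle t_e\rangle$ is a simple $R\Pi\Sigma$-extension of $\mathbb F(x)$ of $x$-degree $\le d$, and $\mathbb S$ is a $\Sigma$-extension of $\mathbb E$ with $\sigma(s_k)-s_k=p_k/\kappa_k^{m_k}$, where $\kappa_k\in Q$, $m_k\ge1$, $0\ne p_k\in\mathbb F[x]\langle t_1\rangle\dots\langle t_e\rangle$ and $\deg_x p_k<m_k\deg_x \kappa_k$. The $s_k$ are the *$Q$-contributions*. A *simple $R\Pi\Sigma$-extension $\mathbb H$ of $\mathbb S$ of $x$-degree $\le d$* is an $R\Pi\Sigma$-extension $\mathbb H=\mathbb S\langle\tau_1\rangle\dots\langle\tau_k\rangle$ such that $\mathbb E':=\mathbb E\langle\tau_1\rangle\dots\langle\tau_k\rangle$ is a simple $R\Pi\Sigma$-extension of $\mathbb F(x)$ of $x$-degree $\le d$ (so the new monomials do not involve the $s_k$, and $\mathbb H=\mathbb E'[s_1,\dots,s_r]$); an element of $\mathbb H$ is *free of the $Q$-contributions* if it lies in $\mathbb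 E'$. **Algorithm.** Input: $\mathbb S$, $Q$ as above and $f\in\mathbb E$. 1. Choose a $(d,x)$-set $\tilde Q=\{q_1,\dots,q_\ell\}\supseteq Q$ that is $(d,\mathrm{den}(f))$-complete. 2. Choose $g\in\mathbb E$, $n_i\ge1$, $p,P_1,\dots,P_\ell\in\mathbb F[x]\langle t_1\rangle\dots\langle t_e\rangle$ with $\deg_x P_i<n_i\deg_x q_i$, and $q\in\mathbb F[x]\setminus\{0\}$ of $x$-degree $\le d$, such that $$\sigma(g)-g+\sum_{i=1}^{\ell}\frac{P_i}{q_i^{n_i}}+\frac pq=f.$$ 3. Start with $Q'=Q$, the ring $\mathbb S$, and $w=0$. For $i=1,\dots,\ell$ with $P_i\ne0$, let $J_i=\{k:\kappa_k=q_i\}$ and let $\mu_i$ be the maximum of $n_i$ and all $m_k$, $k\in J_i$. Let $V_i$ be the $\mathbb K$-space of linear relations between the elements $q_i^{\mu_i-m_k}p_k$ ($k\in J_i$) and, as last element, $q_i^{\mu_i-n_i}P_i$. If $J_i=\emptyset$ or $V_i=0$, put $q_i$ into $Q'$, adjoin to the current ring a new polynomial variable $s$ with $\sigma(s)=s+P_i/q_i^{n_i}$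 and replace $w$ by $w+s$. Otherwise $V_i$ has a basis consisting of one vector with entries $c_k$ ($k\in J_i$) and last entry $-1$; replace $w$ by $w+\sum_{k\in J_i}c_ks_k$. 4. If there is a $\gamma\in\mathbb E$ with $\sigma(\gamma)-\gamma=p/q$, let $\mathbb S'$ be the current ring and $g'=\gamma$. Otherwise, adjoin to the current ring a polynomial variable $t$ with $\sigma(t)=t+p/q$, which gives $\mathbb S'$, and let $g'=t$. Return $h=g+g'+w\in\mathbb S'$, $\mathbb S'$ and $Q'$. **Corollary.** Let $h,\mathbb S',Q'$ be an output of the algorithm. Suppose that there are a simple $R\Pi\Sigma$-extension $\mathbb H$ of $\mathbb S$ of $x$-degree $\le d$ and $h'\in\mathbb H$ with $\sigma(h')-h'=f$. Then $\sigma(h)-h=f$ and the following holds. 1. $Q'=Q$, and $\mathbb S'$ is a $\Sigma$-extension of $\mathbb S$ of $x$-degree $\le d$. 2. If $\mathbb H=\mathbb S$, then $\mathbb S'=\mathbb S$. 3. If $h'$ is free of the $Q$-contributions, then so is $h$. -/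

import Mathlib

open Polynomial

noncomputable section

namespace Telescoping

universe u v w

/-- The constants `{c | σ c = c}` of a difference ring. -/
def constants {R : Type u} [CommRing R] (σ : R ≃+* R) : Subring R :=
  RingHom.eqLocus (σ : R →+* R) (RingHom.id R)

/-! ### The ground field `F(x)` -/

section Ground

variable {F : Type u} [Field F]

/-- `(F(x), σ)` is a ΠΣ-field extension of `(F, σF)` with the single monomial `x`. -/
structure IsPiSigmaFieldExt (σF : F ≃+* F) (σ : RatFunc F ≃+* RatFunc F) : Prop where
  extends_base : ∀ a : F, σ (RatFunc.C a) = RatFunc.C (σF a)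
  monomial : (∃ a : F, a ≠ 0 ∧ σ RatFunc.X = RatFunc.C a * RatFunc.X) ∨
    (∃ b : F, σ RatFunc.X = RatFunc.X + RatFunc.C b)
  const : ∀ c : RatFunc F, σ c = c → ∃ a : F, RatFunc.C a = c

/-- The integer power `σ ^ k` of the automorphism, applied to `h`. -/
def shift (σ : RatFunc F ≃+* RatFunc F) (k : ℤ) (h : RatFunc F) : RatFunc F :=
  ((show RingAut (RatFunc F) from σ) ^ k : RingAut (RatFunc F)) h

/-- The period of `h`: the least `n ≥ 1` with `σ ^ n (h) / h ∈ F`, and `0` if there is none. -/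
def period (σ : RatFunc F ≃+* RatFunc F) (h : RatFunc F) : ℕ :=
  sInf {n : ℕ | 0 < n ∧ ∃ c : F, shift σ n h / h = RatFunc.C c}

/-- `f` and `g` are `σ`-equivalent: `σ ^ k (f) / g ∈ F` for some integer `k`. -/
def SigmaEquivalent (σ : RatFunc F ≃+* RatFunc F) (f g : F[X]) : Prop :=
  ∃ k : ℤ, ∃ c : F,
    shift σ k (algebraMap F[X] (RatFunc F) f) / algebraMap F[X] (RatFunc F) g = RatFunc.C c

/-- The polynomial `f` has `x`-degree `≤ d`: its irreducible factors of period `0` have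
degree at most `d`. -/
def PolyXDegLE (σ : RatFunc F ≃+* RatFunc F) (d : ℕ) (f : F[X]) : Prop :=
  ∀ h : F[X], Irreducible h → h ∣ f → period σ (algebraMap F[X] (RatFunc F) h) = 0 →
    h.natDegree ≤ d

/-- The rational function `f` has `x`-degree `≤ d`: the irreducible factors of period `0` of
its numerator and of its denominator have degree at most `d`. -/
def RatXDegLE (σ : RatFunc F ≃+* RatFunc F) (d : ℕ) (f : RatFunc F) : Prop :=
  PolyXDegLE σ d f.num ∧ PolyXDegLE σ d f.denom

/-- `(d, x)`-sets. -/
structure IsDXSet (σ : RatFunc F ≃+* RatFunc F) (d : ℕ) (Q : Finset F[X]) : Prop where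
  monic : ∀ q ∈ Q, q.Monic
  irreducible : ∀ q ∈ Q, Irreducible q
  degree : ∀ q ∈ Q, d < q.natDegree
  period_zero : ∀ q ∈ Q, period σ (algebraMap F[X] (RatFunc F) q) = 0
  coprime : ∀ q ∈ Q, ∀ r ∈ Q, q ≠ r → ¬ SigmaEquivalent σ q r

/-- The `(d, x)`-set `Q` is `(d, f)`-complete: each irreducible factor of `f` of period `0` and
of degree `> d` is `σ`-equivalent to an element of `Q`. -/
def IsComplete (σ : RatFunc F ≃+* RatFunc F) (d : ℕ) (f : F[X]) (Q : Finset F[X]) : Prop :=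
  IsDXSet σ d Q ∧
    ∀ h : F[X], Irreducible h → h ∣ f → d < h.natDegree →
      period σ (algebraMap F[X] (RatFunc F) h) = 0 → ∃ q ∈ Q, SigmaEquivalent σ q h

end Ground

/-! ### RΠΣ-extensions -/

/-- The three kinds of monomials; an R-monomial carries its order. -/
inductive Kind : Type
  | rootOfUnity (ν : ℕ) : Kind
  | prod : Kind
  | sum : Kind

/-- Integer powers of an element of a ring (used at negative exponents only for units). -/
def ipow {E : Type v} [CommRing E] (y : E) : ℤ → E
  | Int.ofNat k => y ^ k
  | Int.negSucc k => (Ring.inverse y) ^ (k + 1)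

/-- The power product `t₁ ^ n₁ ⋯ tₑ ^ nₑ`. -/
def tpow {E : Type v} [CommRing E] {e : ℕ} (t : Fin e → E) (n : Fin e → ℤ) : E :=
  ∏ j, ipow (t j) (n j)

/-- Reduced exponent vectors. -/
def IsReducedExp {e : ℕ} (kind : Fin e → Kind) (n : Fin e → ℤ) : Prop :=
  ∀ j, match kind j with
    | Kind.rootOfUnity ν => 0 ≤ n j ∧ n j < ν
    | Kind.prod => True
    | Kind.sum => 0 ≤ n j

section Tower

variable {A : Type u} [CommRing A] {E : Type v} [CommRing E]

/-- The subring `A⟨t₁⟩ ⋯ ⟨tᵢ⟩` of `E`, for an extension `φ : A → E`. -/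
def level (φ : A →+* E) {e : ℕ} (kind : Fin e → Kind) (t : Fin e → E) (i : ℕ) : Subring E :=
  Subring.closure (Set.range φ ∪
    {y | ∃ j : Fin e, (j : ℕ) < i ∧ (y = t j ∨ (kind j = Kind.prod ∧ y * t j = 1))})

/-- `t` is an R-, Π- or Σ-monomial over the subring `B` as far as the ring structure of `B⟨t⟩`
and the action of `σ` on `t` are concerned; the condition on the constants is separate. -/
def IsMonomial (σ : E ≃+* E) (B : Subring E) (t : E) : Kind → Prop
  | Kind.rootOfUnity ν => 1 < ν ∧ t ^ ν = 1 ∧ LinearIndependent B (fun k : Fin ν => t ^ (k : ℕ)) ∧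
      ∃ a : B, IsPrimitiveRoot a ν ∧ σ t = (a : E) * t
  | Kind.prod => IsUnit t ∧ LinearIndependent B (fun k : ℤ => ipow t k) ∧
      ∃ a : Bˣ, σ t = ((a : B) : E) * t
  | Kind.sum => Transcendental B t ∧ σ t - t ∈ B

/-- `(E, σE)` is an RΠΣ-extension of `(A, σA)` with the monomials `t₁, …, tₑ` adjoined in this
order; the embedding `A → E` is `φ`. -/
structure IsRPSExtension (σA : A ≃+* A) (σE : E ≃+* E) (φ : A →+* E) {e : ℕ}
    (kind : Fin e → Kind) (t : Fin e → E) : Prop where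
  injective : Function.Injective φ
  extends_base : ∀ a, σE (φ a) = φ (σA a)
  monomial : ∀ i : Fin e, IsMonomial σE (level φ kind t i) (t i) (kind i)
  generate : level φ kind t e = ⊤
  const : ∀ c, σE c = c → ∃ a, φ a = c

/-- The monomials `t₁, …, tₑ` satisfy the conditions of a simple RΠΣ-extension of `A`. -/
structure IsSimple (σE : E ≃+* E) (φ : A →+* E) {e : ℕ} (kind : Fin e → Kind)
    (t : Fin e → E) : Prop where
  root : ∀ i ν, kind i = Kind.rootOfUnity ν → ∃ (a : A) (m : Fin e → ℤ),
    (∃ k : ℕ, 0 < k ∧ a ^ k = 1) ∧ (∀ j, m j ≠ 0 → j < i ∧ ∃ ν', kind j = Kind.rootOfUnity ν') ∧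
    σE (t i) = φ a * tpow t m * t i
  prod : ∀ i, kind i = Kind.prod → ∃ (a : A) (m : Fin e → ℤ),
    IsUnit a ∧ (∀ j, m j ≠ 0 → j < i ∧ kind j ≠ Kind.sum) ∧
    σE (t i) = φ a * tpow t m * t i

/-- `f = ∑ cₙ tⁿ`, the sum over reduced exponent vectors. -/
def IsRepr (φ : A →+* E) {e : ℕ} (kind : Fin e → Kind) (t : Fin e → E) (f : E)
    (c : (Fin e → ℤ) →₀ A) : Prop :=
  (∀ n ∈ c.support, IsReducedExp kind n) ∧ f = c.sum fun n a => φ a * tpow t n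

end Tower

/-! ### Extensions of `F(x)` of bounded `x`-degree -/

section Degree

variable {F : Type u} [Field F] {E : Type v} [CommRing E]

/-- `b` is the monic least common multiple of the family `g` over the finite set `s`. -/
def IsMonicLcm {ι : Type*} (s : Finset ι) (g : ι → F[X]) (b : F[X]) : Prop :=
  b.Monic ∧ ∀ a : F[X], b ∣ a ↔ ∀ i ∈ s, g i ∣ a

/-- `den(f) = b`, the monic least common multiple of the denominators of the coefficients of
`f ∈ F(x)⟨t₁⟩ ⋯ ⟨tₑ⟩`. In particular `f` lies in this ring. -/
def IsDen (φ : RatFunc F →+* E) {e : ℕ} (kind : Fin e → Kind) (t : Fin e → E) (f : E)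
    (b : F[X]) : Prop :=
  ∃ c, IsRepr φ kind t f c ∧ IsMonicLcm c.support (fun n => (c n).denom) b

/-- `f ∈ F[x]⟨t₁⟩ ⋯ ⟨tₑ⟩`. -/
def IsPolyElt (φ : RatFunc F →+* E) {e : ℕ} (kind : Fin e → Kind) (t : Fin e → E) (f : E) : Prop :=
  ∃ c, IsRepr (φ.comp (algebraMap F[X] (RatFunc F))) kind t f c

/-- `f ∈ F[x]⟨t₁⟩ ⋯ ⟨tₑ⟩` with `deg_x(f) < N`. -/
def IsPolyEltDegLT (φ : RatFunc F →+* E) {e : ℕ} (kind : Fin e → Kind) (t : Fin e → E) (f : E)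
    (N : ℕ) : Prop :=
  ∃ c, IsRepr (φ.comp (algebraMap F[X] (RatFunc F))) kind t f c ∧ ∀ n, (c n).degree < N

/-- The element `p / q ^ n` of `E`. -/
def frac (φ : RatFunc F →+* E) (p : E) (q : F[X]) (n : ℕ) : E :=
  φ ((algebraMap F[X] (RatFunc F) q ^ n)⁻¹) * p

/-- The monomials `t₁, …, tₑ` satisfy the conditions of a simple RΠΣ-extension of `F(x)` with
`x`-degree `≤ d`. -/
structure HasXDegLE (σ : RatFunc F ≃+* RatFunc F) (σE : E ≃+* E) (φ : RatFunc F →+* E) (d : ℕ)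
    {e : ℕ} (kind : Fin e → Kind) (t : Fin e → E) : Prop where
  simple : IsSimple σE φ kind t
  prod : ∀ i, kind i = Kind.prod → ∃ (a : RatFunc F) (m : Fin e → ℤ),
    a ≠ 0 ∧ RatXDegLE σ d a ∧ (∀ j, m j ≠ 0 → j < i ∧ kind j ≠ Kind.sum) ∧
    σE (t i) = φ a * tpow t m * t i
  sum : ∀ i, kind i = Kind.sum → ∃ b, IsDen φ kind t (σE (t i) - t i) b ∧ PolyXDegLE σ d b

/-- The data of the `Q`-contributions `s₁, …, sᵤ`, to be used with
`σ(sₖ) - sₖ = pₖ / qₖ ^ mₖ`. -/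
structure QData (F : Type u) [Field F] (E : Type v) (r : ℕ) where
  q : Fin r → F[X]
  m : Fin r → ℕ
  p : Fin r → E

/-- `S = E[s₁, …, sᵣ]` with `E = F(x)⟨t₁⟩ ⋯ ⟨tₑ⟩` is a `(d, x, Q)`-reduced RΠΣ-extension of
`F(x)`, with `Q`-contributions `s₁, …, sᵣ`. -/
structure IsQReduced {S : Type w} [CommRing S] (σ : RatFunc F ≃+* RatFunc F) (σE : E ≃+* E)
    (φ : RatFunc F →+* E) (d : ℕ) {e : ℕ} (kind : Fin e → Kind) (t : Fin e → E)
    (Q : Finset F[X]) (σS : S ≃+* S) (ψ : E →+* S) {r : ℕ} (s : Fin r → S)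
    (D : QData F E r) : Prop where
  base_ext : IsRPSExtension σ σE φ kind t
  base_deg : HasXDegLE σ σE φ d kind t
  dxSet : IsDXSet σ d Q
  sum_ext : IsRPSExtension σE σS ψ (fun _ => Kind.sum) s
  mem : ∀ k, D.q k ∈ Q
  exponent : ∀ k, 1 ≤ D.m k
  ne_zero : ∀ k, D.p k ≠ 0
  numerator : ∀ k, IsPolyEltDegLT φ kind t (D.p k) (D.m k * (D.q k).natDegree)
  shift_eq : ∀ k, σS (s k) - s k = ψ (frac φ (D.p k) (D.q k) (D.m k))

/-- For `S = E[s₁, …, sᵣ]` with `E = F(x)⟨t₁⟩ ⋯ ⟨tₑ⟩`: the ring `H`, with new monomials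
`τ₁, …, τₖ`, is a simple RΠΣ-extension of `S` with `x`-degree `≤ d`. That is, `H` is an
RΠΣ-extension of `S`, and `E⟨τ₁⟩ ⋯ ⟨τₖ⟩ = F(x)⟨t₁⟩ ⋯ ⟨tₑ⟩⟨τ₁⟩ ⋯ ⟨τₖ⟩` satisfies the conditions of
a simple RΠΣ-extension of `F(x)` with `x`-degree `≤ d`. -/
structure IsXDegExtension {S : Type w} [CommRing S] {H : Type*} [CommRing H]
    (σ : RatFunc F ≃+* RatFunc F) (φ : RatFunc F →+* E) (d : ℕ) {e : ℕ} (kind : Fin e → Kind)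
    (t : Fin e → E) (σS : S ≃+* S) (ψ : E →+* S) (σH : H ≃+* H) (ι : S →+* H) {k : ℕ}
    (kindH : Fin k → Kind) (τ : Fin k → H) : Prop where
  ext : IsRPSExtension σS σH ι kindH τ
  deg : HasXDegLE σ σH ((ι.comp ψ).comp φ) d (Fin.append kind kindH)
    (Fin.append (fun i => ι (ψ (t i))) τ)

end Degree

/-! ### The algorithm -/

/-- `Ann_K(a)`, the `K`-vector space of the `K`-linear relations of a finite family `a` in a ring
that contains `K` by means of `φ`. -/
def annihilator {K : Type u} [CommRing K] {E : Type v} [CommRing E] (φ : K →+* E) {ι : Type*}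
    [Fintype ι] (a : ι → E) : Submodule K (ι → K) where
  carrier := {c | ∑ i, φ (c i) * a i = 0}
  zero_mem' := by simp
  add_mem' := by
    intro c c' hc hc'
    simp only [Set.mem_ofPred_eq, Pi.add_apply, map_add, add_mul, Finset.sum_add_distrib] at *
    rw [hc, hc', add_zero]
  smul_mem' := by
    intro k c hc
    simp only [Set.mem_ofPred_eq, Pi.smul_apply, smul_eq_mul, map_mul, mul_assoc] at *
    rw [← Finset.mul_sum, hc, mul_zero]

/-- The automorphism of `R[X]` that extends `σ` and maps `X` to `X + β`. -/
def polyShift {R : Type w} [CommRing R] (σ : R ≃+* R) (β : R) : R[X] ≃+* R[X] :=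
  (Polynomial.mapEquiv σ).trans (Polynomial.algEquivAevalXAddC β).toRingEquiv

theorem polyShift_X {R : Type w} [CommRing R] (σ : R ≃+* R) (β : R) :
    polyShift σ β X = X + C β := by
  simp [polyShift]

theorem polyShift_C {R : Type w} [CommRing R] (σ : R ≃+* R) (β a : R) :
    polyShift σ β (C a) = C (σ a) := by
  simp [polyShift]

/-- A difference ring over `S`, with the list of the generators adjoined to `S` so far. -/
structure DiffExt (S : Type w) [CommRing S] where
  R : Type w
  [ring : CommRing R]
  σ : R ≃+* R
  emb : S →+* R
  n : ℕ
  gen : Fin n → R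

attribute [instance] DiffExt.ring

section Algorithm

variable {F : Type u} [Field F] {E : Type v} [CommRing E] {S : Type w} [CommRing S]

/-- The difference ring `(S, σ)` over itself, with no generators. -/
def DiffExt.init (σS : S ≃+* S) : DiffExt S where
  R := S
  σ := σS
  emb := RingHom.id S
  n := 0
  gen := Fin.elim0

/-- Adjoin a new variable `X`, transcendental over the ring, with `σ(X) = X + β`. -/
def DiffExt.adjoin (T : DiffExt S) (β : T.R) : DiffExt S where
  R := T.R[X]
  σ := polyShift T.σ β
  emb := C.comp T.emb
  n := T.n + 1
  gen := Fin.snoc (fun i => C (T.gen i)) X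

/-- The variables of the algorithm: the current ring `S_u`, the set `Q'`, and `w ∈ S_u`. -/
structure AlgState (F : Type u) [Field F] (S : Type w) [CommRing S] where
  ext : DiffExt S
  Q : Finset F[X]
  w : ext.R

/-- The output `(h, S', Q')` of the algorithm. -/
structure AlgOutput (F : Type u) [Field F] (S : Type w) [CommRing S] where
  ext : DiffExt S
  Q : Finset F[X]
  h : ext.R

open Classical in
/-- `w := w + X` and `Q' := Q' ∪ {q}` after adjoining a new variable `X` with
`σ(X) = X + β`. -/
def AlgState.adjoin (T : AlgState F S) (q : F[X]) (β : T.ext.R) : AlgState F S where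
  ext := T.ext.adjoin β
  Q := insert q T.Q
  w := (C T.w + X : T.ext.R[X])

/-- `w := w + a`. -/
def AlgState.addW (T : AlgState F S) (a : T.ext.R) : AlgState F S where
  ext := T.ext
  Q := T.Q
  w := T.w + a

variable {r : ℕ}

/-- The indices of the `Q`-contributions that belong to `q`. -/
abbrev QData.Idx (D : QData F E r) (q : F[X]) : Type := {k : Fin r // D.q k = q}

open Classical in
/-- The maximum `μ` of `n` and of the exponents of the `Q`-contributions that belong to `q`. -/
def QData.maxExp (D : QData F E r) (q : F[X]) (n : ℕ) : ℕ :=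
  max n (Finset.univ.sup fun k : D.Idx q => D.m k)

/-- The family of all `q ^ (μ - mₖ) pₖ`, for the `Q`-contributions that belong to `q`, and of
`q ^ (μ - n) p` as its last member (with index `none`). -/
def QData.family (φ : RatFunc F →+* E) (D : QData F E r) (q : F[X]) (n : ℕ) (p : E) :
    Option (D.Idx q) → E
  | none => φ (algebraMap F[X] (RatFunc F) q ^ (D.maxExp q n - n)) * p
  | some k => φ (algebraMap F[X] (RatFunc F) q ^ (D.maxExp q n - D.m k)) * D.p k

open Classical in
/-- The space `V` of the relations over the constants between the members of this family. -/
def QData.relations (σF : F ≃+* F) (φ : RatFunc F →+* E) (D : QData F E r) (q : F[X]) (n : ℕ)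
    (p : E) : Submodule (constants σF) (Option (D.Idx q) → constants σF) :=
  annihilator ((φ.comp RatFunc.C).comp (constants σF).subtype) (D.family φ q n p)

open Classical in
/-- Execution of the loop of the algorithm over a list of polynomials `q`, for given numerators
`p q` and exponents `n q`: it relates the state before to the state after the loop. -/
inductive LoopRun (σF : F ≃+* F) (φ : RatFunc F →+* E) (ψ : E →+* S) (s : Fin r → S)
    (D : QData F E r) (p : F[X] → E) (n : F[X] → ℕ) :
    List F[X] → AlgState F S → AlgState F S → Prop
  | done (T : AlgState F S) : LoopRun σF φ ψ s D p n [] T T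
  /- `p q = 0`: nothing to do. -/
  | skip (q : F[X]) (l : List F[X]) (T T' : AlgState F S) (hp : p q = 0)
      (hrest : LoopRun σF φ ψ s D p n l T T') :
      LoopRun σF φ ψ s D p n (q :: l) T T'
  /- `p q ≠ 0` and the basis `B` is empty: adjoin a new variable. -/
  | adjoin (q : F[X]) (l : List F[X]) (T T' : AlgState F S) (hp : p q ≠ 0)
      (hB : IsEmpty (D.Idx q) ∨ D.relations σF φ q (n q) (p q) = ⊥)
      (hrest : LoopRun σF φ ψ s D p n l
        (T.adjoin q (T.ext.emb (ψ (frac φ (p q) q (n q))))) T') :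
      LoopRun σF φ ψ s D p n (q :: l) T T'
  /- `p q ≠ 0` and `B = {(c, -1)}`: use the available `Q`-contributions. -/
  | combine (q : F[X]) (l : List F[X]) (T T' : AlgState F S) (hp : p q ≠ 0)
      (hne : Nonempty (D.Idx q)) (c : Option (D.Idx q) → constants σF)
      (hB : D.relations σF φ q (n q) (p q) = Submodule.span (constants σF) {c})
      (hc : c none = -1)
      (hrest : LoopRun σF φ ψ s D p n l
        (T.addW (∑ k : D.Idx q,
          T.ext.emb (ψ (φ (RatFunc.C ((c (some k) : constants σF) : F))) * s k))) T') :
      LoopRun σF φ ψ s D p n (q :: l) T T'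

/-- The last two steps of the algorithm, for the fraction `ρ = p / q` and for `g`. -/
inductive FinalRun (σE : E ≃+* E) (ψ : E →+* S) (g ρ : E) :
    AlgState F S → AlgOutput F S → Prop
  | solved (T : AlgState F S) (γ : E) (hγ : σE γ - γ = ρ) :
      FinalRun σE ψ g ρ T ⟨T.ext, T.Q, T.ext.emb (ψ g) + T.ext.emb (ψ γ) + T.w⟩
  | extend (T : AlgState F S) (hγ : ¬ ∃ γ : E, σE γ - γ = ρ) :
      FinalRun σE ψ g ρ T ⟨T.ext.adjoin (T.ext.emb (ψ ρ)), T.Q,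
        (C (T.ext.emb (ψ g)) + X + C T.w : T.ext.R[X])⟩

/-- `out` is an output of the algorithm (for some admissible choice of the completion `Qt` of
`Q`, of the `σ`-reduced form of `f`, of the order of the loop, and of `γ`). -/
def IsAlgOutput (σF : F ≃+* F) (σ : RatFunc F ≃+* RatFunc F) (σE : E ≃+* E)
    (φ : RatFunc F →+* E) (d : ℕ) {e : ℕ} (kind : Fin e → Kind) (t : Fin e → E)
    (Q : Finset F[X]) (σS : S ≃+* S) (ψ : E →+* S) (s : Fin r → S) (D : QData F E r) (f : E)
    (out : AlgOutput F S) : Prop :=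
  ∃ (Qt : Finset F[X]) (b : F[X]) (g : E) (p : F[X] → E) (n : F[X] → ℕ) (p₀ : E) (q₀ : F[X])
    (l : List F[X]) (T : AlgState F S),
    Q ⊆ Qt ∧ IsDen φ kind t f b ∧ IsComplete σ d b Qt ∧
    σE g - g + ((∑ q ∈ Qt, frac φ (p q) q (n q)) + frac φ p₀ q₀ 1) = f ∧
    (∀ q ∈ Qt, 1 ≤ n q) ∧
    q₀ ≠ 0 ∧ PolyXDegLE σ d q₀ ∧ IsPolyElt φ kind t p₀ ∧
    (∀ q ∈ Qt, IsPolyEltDegLT φ kind t (p q) (n q * q.natDegree)) ∧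
    l.Nodup ∧ (∀ q, q ∈ l ↔ q ∈ Qt) ∧
    LoopRun σF φ ψ s D p n l ⟨DiffExt.init σS, Q, (0 : S)⟩ T ∧
    FinalRun σE ψ g (frac φ p₀ q₀ 1) T out

end Algorithm

end Telescoping

end

/-! Put `E' = E⟨τ₁⟩⋯⟨τₖ⟩`, so that `H = E'[s₁, …, sᵣ]`. Two facts pin down every solution `h'` in
`H`.

Linearity. Each `σ(sⱼ) - sⱼ` comes from `E` and all constants lie in `E'`. Comparing the two top
coefficients of a polynomial in the last `sⱼ` shows, in characteristic 0, that `σ(h') - h' ∈ E'`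
forces `h' = ∑ cⱼ sⱼ + e'` with constants `cⱼ` and `e' ∈ E'` (`exists_linear_of_shift_sub_mem`).

Poles. With the reduced form of `f` inserted, `G = e' - g` satisfies `σ(G) - G = ∑ Y q + p₀ / q₀`,
where `Y q` is the given fraction at `q` minus the combination by the `cⱼ` of the fractions of the
contributions at `q`. Since the monomials of `E'` have x-degree `≤ d`, `G` has no pole at `σ ^ k
(q)` iff `σ(G)` has none at `σ ^ (k + 1) (q)`. Now `G` has poles at finitely many shifts of `q`, and
the right-hand side at most at `q` itself. Moving in from both ends of the orbit, neither `G` nor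
`σ(G)` has a pole at `q` (`mem_localRing_of_shift_sub`). Hence `Y q`, a proper fraction without pole
at `q`, is zero.

So each fraction at `q` is a constant combination of the available ones (`exists_decomposition`).
The loop never adjoins a variable, and its `w ∈ S` telescopes the sum of the fractions
(`LoopRun.exists_w`). Only `p₀ / q₀` can need a new variable. The decomposition for `H = S` turns a
solution of its equation in `S` into one in `E` (`IsQReduced.exists_of_exists`), so a variable is
adjoined only if `S` has no solution, and then it adds no constants (`eq_C_of_polyShift_eq`). If `H
= S`, the same descent, applied to `h'`, shows that no variable is needed. If `h'` is free of the
contributions, all `cⱼ` can be taken zero; then all numerators vanish and `w = 0`. -/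

noncomputable section

namespace Telescoping

universe u v w

/-! ### Power products with integer exponents -/

section Generic

variable {A : Type u} [CommRing A] {E : Type v} [CommRing E]

theorem inverse_eq_of_mul_eq_one {x y : E} (h : x * y = 1) : Ring.inverse x = y := by
  have hx : IsUnit x := IsUnit.of_mul_eq_one y h
  calc Ring.inverse x = Ring.inverse x * (x * y) := by rw [h, mul_one]
    _ = y := by rw [← mul_assoc, Ring.inverse_mul_cancel x hx, one_mul]

theorem ipow_unit (y : Eˣ) (a : ℤ) : ipow (y : E) a = ((y ^ a : Eˣ) : E) := by
  cases a with
  | ofNat k => simp [ipow]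
  | negSucc k => simp [ipow, zpow_negSucc]

@[simp] theorem ipow_zero (y : E) : ipow y 0 = 1 := by
  change y ^ 0 = 1
  simp

@[simp] theorem ipow_one (y : E) : ipow y 1 = y := by
  change y ^ 1 = y
  simp

theorem ipow_natCast (y : E) (k : ℕ) : ipow y k = y ^ k := rfl

/-- Negative exponents go through `Ring.inverse`, which homomorphisms respect on units but not in
general. -/
theorem map_ipow {H : Type*} [CommRing H] (χ : E →+* H) (y : E) (a : ℤ) (h : 0 ≤ a ∨ IsUnit y) :
    χ (ipow y a) = ipow (χ y) a := by
  rcases h with h | ⟨y, rfl⟩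
  · lift a to ℕ using h
    simp [ipow_natCast]
  · have h2 : χ (y : E) = ((Units.map (χ : E →* H) y : Hˣ) : H) := rfl
    rw [h2, ipow_unit, ipow_unit, ← map_zpow]
    rfl

theorem map_tpow {H : Type*} [CommRing H] (χ : E →+* H) {e : ℕ} (t : Fin e → E) (n : Fin e → ℤ)
    (h : ∀ j, 0 ≤ n j ∨ IsUnit (t j)) : χ (tpow t n) = tpow (fun j => χ (t j)) n := by
  simp only [tpow, map_prod]
  exact Finset.prod_congr rfl fun j _ => map_ipow χ _ _ (h j)

@[simp] theorem tpow_zero {e : ℕ} (t : Fin e → E) : tpow t 0 = 1 := by simp [tpow]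

theorem tpow_append {e k : ℕ} (t : Fin e → E) (τ : Fin k → E) (n : Fin (e + k) → ℤ) :
    tpow (Fin.append t τ) n =
      tpow t (fun j => n (Fin.castAdd k j)) * tpow τ (fun j => n (Fin.natAdd e j)) := by
  simp [tpow, Fin.prod_univ_add]

theorem tpow_single {e : ℕ} (t : Fin e → E) (i : Fin e) (a : ℤ) :
    tpow t (Pi.single i a) = ipow (t i) a := by
  rw [tpow, Finset.prod_eq_single i]
  · simp
  · intro j _ hj
    simp [Pi.single_eq_of_ne hj]
  · simp

theorem tpow_update {e : ℕ} (t : Fin e → E) (n : Fin e → ℤ) (i : Fin e) :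
    tpow t n = tpow t (Function.update n i 0) * ipow (t i) (n i) := by
  rw [tpow, tpow, ← Finset.mul_prod_erase _ _ (Finset.mem_univ i),
    ← Finset.mul_prod_erase (a := i) (f := fun j => ipow (t j) (Function.update n i 0 j)) _
      (Finset.mem_univ i)]
  have : ∏ x ∈ Finset.univ.erase i, ipow (t x) (n x) =
      ∏ x ∈ Finset.univ.erase i, ipow (t x) (Function.update n i 0 x) := by
    refine Finset.prod_congr rfl fun j hj => ?_
    rw [Function.update_of_ne (Finset.ne_of_mem_erase hj)]
  rw [this]
  simp [mul_comm]

/-! ### Units of subrings -/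

/-- `x` is a unit of the subring `L`. -/
def UnitIn (L : Subring E) (x : E) : Prop := x ∈ L ∧ ∃ y ∈ L, x * y = 1

theorem UnitIn.one (L : Subring E) : UnitIn L 1 := ⟨L.one_mem, 1, L.one_mem, mul_one 1⟩

theorem UnitIn.mul {L : Subring E} {x y : E} (hx : UnitIn L x) (hy : UnitIn L y) :
    UnitIn L (x * y) := by
  obtain ⟨hx, x', hx', hxx⟩ := hx
  obtain ⟨hy, y', hy', hyy⟩ := hy
  refine ⟨L.mul_mem hx hy, x' * y', L.mul_mem hx' hy', ?_⟩
  rw [mul_mul_mul_comm, hxx, hyy, one_mul]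

theorem UnitIn.pow {L : Subring E} {x : E} (hx : UnitIn L x) (n : ℕ) : UnitIn L (x ^ n) := by
  induction n with
  | zero => simpa using UnitIn.one L
  | succ n ih => rw [pow_succ]; exact ih.mul hx

theorem UnitIn.inverse {L : Subring E} {x : E} (hx : UnitIn L x) : UnitIn L (Ring.inverse x) := by
  obtain ⟨hx, y, hy, hxy⟩ := hx
  rw [inverse_eq_of_mul_eq_one hxy]
  exact ⟨hy, x, hx, by rw [mul_comm, hxy]⟩

theorem UnitIn.ipow {L : Subring E} {x : E} (hx : UnitIn L x) (n : ℤ) :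
    UnitIn L (ipow x n) := by
  cases n with
  | ofNat k => exact hx.pow k
  | negSucc k => exact hx.inverse.pow (k + 1)

theorem UnitIn.tpow {L : Subring E} {e : ℕ} {t : Fin e → E} {n : Fin e → ℤ}
    (h : ∀ j, n j ≠ 0 → UnitIn L (t j)) : UnitIn L (tpow t n) := by
  refine Finset.prod_induction _ (UnitIn L) (fun _ _ => UnitIn.mul) (UnitIn.one L) fun j _ => ?_
  by_cases hj : n j = 0
  · simpa [hj] using UnitIn.one L
  · exact (h j hj).ipow _

theorem UnitIn.mono {L M : Subring E} (h : L ≤ M) {x : E} (hx : UnitIn L x) : UnitIn M x :=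
  ⟨h hx.1, hx.2.choose, h hx.2.choose_spec.1, hx.2.choose_spec.2⟩

theorem UnitIn.map {H : Type*} [CommRing H] (χ : E →+* H) {L : Subring E} {M : Subring H}
    (h : ∀ x ∈ L, χ x ∈ M) {x : E} (hx : UnitIn L x) : UnitIn M (χ x) := by
  obtain ⟨hx, y, hy, hxy⟩ := hx
  exact ⟨h x hx, χ y, h y hy, by rw [← map_mul, hxy, map_one]⟩

theorem UnitIn.mem_of_mul_eq_one {L : Subring E} {x y : E} (hx : UnitIn L x) (h : y * x = 1) :
    y ∈ L := by
  obtain ⟨_, z, hz, hxz⟩ := hx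
  have : y = z := by rw [← mul_one y, ← hxz, ← mul_assoc, h, one_mul]
  rwa [this]

/-! ### Admissible generators and normal forms -/

/-- R-monomials are roots of unity and Π-monomials are units. -/
structure Admissible {e : ℕ} (kind : Fin e → Kind) (t : Fin e → E) : Prop where
  root : ∀ i ν, kind i = Kind.rootOfUnity ν → 1 < ν ∧ t i ^ ν = 1
  prod : ∀ i, kind i = Kind.prod → IsUnit (t i)

theorem Admissible.isUnit {e : ℕ} {kind : Fin e → Kind} {t : Fin e → E}
    (h : Admissible kind t) (i : Fin e) (hi : kind i ≠ Kind.sum) : IsUnit (t i) := by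
  cases hk : kind i with
  | rootOfUnity ν =>
    obtain ⟨h1, h2⟩ := h.root i ν hk
    exact IsUnit.of_pow_eq_one h2 (by omega)
  | prod => exact h.prod i hk
  | sum => exact absurd hk hi

theorem IsReducedExp.nonneg_or_isUnit {e : ℕ} {kind : Fin e → Kind} {t : Fin e → E}
    (h : Admissible kind t) {n : Fin e → ℤ} (hn : IsReducedExp kind n) (j : Fin e) :
    0 ≤ n j ∨ IsUnit (t j) := by
  by_cases hk : kind j = Kind.sum
  · have := hn j
    rw [hk] at this
    exact Or.inl this
  · exact Or.inr (h.isUnit j hk)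

theorem IsRPSExtension.admissible {σA : A ≃+* A} {σE : E ≃+* E} {φ : A →+* E} {e : ℕ}
    {kind : Fin e → Kind} {t : Fin e → E} (h : IsRPSExtension σA σE φ kind t) :
    Admissible kind t where
  root i ν hi := by
    have := h.monomial i
    rw [hi] at this
    exact ⟨this.1, this.2.1⟩
  prod i hi := by
    have := h.monomial i
    rw [hi] at this
    exact this.1

/-- The subring generated by the image of `O` and by the monomials with index `< i`. -/
def levelOver (φ : A →+* E) (O : Subring A) {e : ℕ} (kind : Fin e → Kind) (t : Fin e → E)
    (i : ℕ) : Subring E :=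
  Subring.closure (φ '' O ∪
    {y | ∃ j : Fin e, (j : ℕ) < i ∧ (y = t j ∨ (kind j = Kind.prod ∧ y * t j = 1))})

theorem level_eq_levelOver (φ : A →+* E) {e : ℕ} (kind : Fin e → Kind) (t : Fin e → E) (i : ℕ) :
    level φ kind t i = levelOver φ ⊤ kind t i := by
  simp [level, levelOver]

theorem level_comp_eq_levelOver {H : Type*} [CommRing H] (φ : A →+* E) (χ : E →+* H) {e : ℕ}
    (kind : Fin e → Kind) (t : Fin e → H) (i : ℕ) :
    level (χ.comp φ) kind t i = levelOver χ φ.range kind t i := by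
  simp [level, levelOver, ← Set.range_comp]

variable {φ : A →+* E} {O : Subring A} {e : ℕ} {kind : Fin e → Kind} {t : Fin e → E}

theorem map_mem_levelOver {a : A} (ha : a ∈ O) (i : ℕ) : φ a ∈ levelOver φ O kind t i :=
  Subring.subset_closure (Or.inl ⟨a, ha, rfl⟩)

theorem gen_mem_levelOver {j : Fin e} {i : ℕ} (hj : (j : ℕ) < i) :
    t j ∈ levelOver φ O kind t i :=
  Subring.subset_closure (Or.inr ⟨j, hj, Or.inl rfl⟩)

theorem inv_mem_levelOver {j : Fin e} {i : ℕ} (hj : (j : ℕ) < i) (hk : kind j = Kind.prod)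
    {y : E} (hy : y * t j = 1) : y ∈ levelOver φ O kind t i :=
  Subring.subset_closure (Or.inr ⟨j, hj, Or.inr ⟨hk, hy⟩⟩)

theorem levelOver_le {O : Subring A} {i : ℕ} {L : Subring E} (h₁ : ∀ a ∈ O, φ a ∈ L)
    (h₂ : ∀ j : Fin e, (j : ℕ) < i → t j ∈ L)
    (h₃ : ∀ j : Fin e, (j : ℕ) < i → kind j = Kind.prod → ∀ y, y * t j = 1 → y ∈ L) :
    levelOver φ O kind t i ≤ L := by
  rw [levelOver, Subring.closure_le]
  rintro y (⟨a, ha, rfl⟩ | ⟨j, hj, rfl | ⟨hk, hy⟩⟩)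
  · exact h₁ a ha
  · exact h₂ j hj
  · exact h₃ j hj hk y hy

theorem levelOver_mono {O O' : Subring A} (hO : O ≤ O') {i i' : ℕ} (hi : i ≤ i') :
    levelOver φ O kind t i ≤ levelOver φ O' kind t i' :=
  levelOver_le (fun _ ha => map_mem_levelOver (hO ha) _)
    (fun _ hj => gen_mem_levelOver (hj.trans_le hi))
    (fun _ hj hk _ hy => inv_mem_levelOver (hj.trans_le hi) hk hy)

theorem unitIn_gen (ht : Admissible kind t) {j : Fin e} {i : ℕ} (hj : (j : ℕ) < i)
    (hk : kind j ≠ Kind.sum) : UnitIn (levelOver φ O kind t i) (t j) := by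
  refine ⟨gen_mem_levelOver hj, ?_⟩
  cases hk' : kind j with
  | rootOfUnity ν =>
    obtain ⟨h1, h2⟩ := ht.root j ν hk'
    refine ⟨t j ^ (ν - 1), Subring.pow_mem _ (gen_mem_levelOver hj) _, ?_⟩
    rw [← pow_succ', Nat.sub_add_cancel h1.le, h2]
  | prod =>
    obtain ⟨y, hy⟩ := (ht.prod j hk').exists_right_inv
    exact ⟨y, inv_mem_levelOver hj hk' (by rw [mul_comm, hy]), hy⟩
  | sum => exact absurd hk' hk

theorem tpow_mem_levelOver (ht : Admissible kind t) {n : Fin e → ℤ} {i : ℕ}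
    (hn : IsReducedExp kind n) (hi : ∀ j : Fin e, i ≤ j → n j = 0) :
    tpow t n ∈ levelOver φ O kind t i := by
  refine Subring.prod_mem _ fun j _ => ?_
  by_cases hj : (j : ℕ) < i
  · by_cases hk : kind j = Kind.sum
    · have := hn j
      rw [hk] at this
      obtain ⟨a, ha⟩ := Int.eq_ofNat_of_zero_le this
      rw [ha, ipow_natCast]
      exact Subring.pow_mem _ (gen_mem_levelOver hj) _
    · exact ((unitIn_gen ht hj hk).ipow _).1
  · rw [hi j (not_lt.1 hj), ipow_zero]
    exact Subring.one_mem _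

/-- Exponents add up, and at an R-monomial of order `ν` they are reduced modulo `ν`. No coefficient
is produced on the way. -/
theorem exists_reduced_mul (ht : Admissible kind t) {n m : Fin e → ℤ} {i : ℕ}
    (hn : IsReducedExp kind n) (hni : ∀ j : Fin e, i ≤ j → n j = 0)
    (hm : IsReducedExp kind m) (hmi : ∀ j : Fin e, i ≤ j → m j = 0) :
    ∃ l, IsReducedExp kind l ∧ (∀ j : Fin e, i ≤ j → l j = 0) ∧
      tpow t n * tpow t m = tpow t l := by
  have key : ∀ j, ∃ a : ℤ, (match kind j with
      | Kind.rootOfUnity ν => 0 ≤ a ∧ a < ν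
      | Kind.prod => True
      | Kind.sum => 0 ≤ a) ∧ (i ≤ (j : ℕ) → a = 0) ∧
      ipow (t j) (n j) * ipow (t j) (m j) = ipow (t j) a := by
    intro j
    have h1 := hn j
    have h2 := hm j
    cases hk : kind j with
    | rootOfUnity ν =>
      obtain ⟨hν, htν⟩ := ht.root j ν hk
      obtain ⟨y, hy⟩ := ht.isUnit j (by simp [hk])
      refine ⟨(n j + m j) % ν, ⟨Int.emod_nonneg _ (by omega), Int.emod_lt_of_pos _ (by omega)⟩,
        fun hj => by simp [hni j hj, hmi j hj], ?_⟩
      rw [← hy] at htν ⊢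
      rw [ipow_unit, ipow_unit, ipow_unit, ← Units.val_mul, ← zpow_add]
      conv_lhs => rw [← Int.emod_add_mul_ediv (n j + m j) ν, zpow_add, zpow_mul]
      have : y ^ ν = 1 := Units.ext (by simpa using htν)
      simp [this]
    | prod =>
      obtain ⟨y, hy⟩ := ht.prod j hk
      refine ⟨n j + m j, trivial, fun hj => by simp [hni j hj, hmi j hj], ?_⟩
      rw [← hy, ipow_unit, ipow_unit, ipow_unit, ← Units.val_mul, ← zpow_add]
    | sum =>
      rw [hk] at h1 h2
      refine ⟨n j + m j, add_nonneg h1 h2, fun hj => by simp [hni j hj, hmi j hj], ?_⟩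
      obtain ⟨a, ha⟩ := Int.eq_ofNat_of_zero_le h1
      obtain ⟨b, hb⟩ := Int.eq_ofNat_of_zero_le h2
      rw [ha, hb, ← Nat.cast_add, ipow_natCast, ipow_natCast, ipow_natCast, pow_add]
  choose l hl using key
  refine ⟨l, fun j => (hl j).1, fun j => (hl j).2.1, ?_⟩
  rw [tpow, tpow, tpow, ← Finset.prod_mul_distrib]
  exact Finset.prod_congr rfl fun j _ => (hl j).2.2

theorem isReducedExp_zero (ht : Admissible kind t) : IsReducedExp kind 0 := by
  intro j
  cases hk : kind j with
  | rootOfUnity ν => have := (ht.root j ν hk).1; simp; omega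
  | prod => trivial
  | sum => simp

theorem isReducedExp_single (ht : Admissible kind t) (i : Fin e) :
    IsReducedExp kind (Pi.single i 1) := by
  intro j
  by_cases hj : j = i
  · subst hj
    cases hk : kind j with
    | rootOfUnity ν => have := (ht.root j ν hk).1; simp; omega
    | prod => trivial
    | sum => simp
  · have := isReducedExp_zero ht j
    simpa [Pi.single_eq_of_ne hj] using this

/-- The elements with normal form over `O`, as an additive group. -/
def normalForms (φ : A →+* E) (O : AddSubgroup A) (kind : Fin e → Kind) (t : Fin e → E) (i : ℕ) :
    AddSubgroup E where
  carrier := {f | ∃ c : (Fin e → ℤ) →₀ A, (∀ n, c n ∈ O) ∧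
    (∀ n ∈ c.support, IsReducedExp kind n ∧ ∀ j : Fin e, i ≤ j → n j = 0) ∧
    f = c.sum fun n a => φ a * tpow t n}
  zero_mem' := ⟨0, by simp [O.zero_mem]⟩
  add_mem' := by
    classical
    rintro _ _ ⟨c, hc, hc', rfl⟩ ⟨b, hb, hb', rfl⟩
    refine ⟨c + b, fun n => O.add_mem (hc n) (hb n), fun n hn => ?_, ?_⟩
    · rcases Finset.mem_union.1 (Finsupp.support_add hn) with h | h
      exacts [hc' n h, hb' n h]
    · rw [Finsupp.sum_add_index'] <;> simp [add_mul]
  neg_mem' := by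
    rintro _ ⟨c, hc, hc', rfl⟩
    refine ⟨-c, fun n => O.neg_mem (hc n), fun n hn => hc' n (by simpa using hn), ?_⟩
    rw [Finsupp.sum_neg_index (by simp)]
    simp [Finsupp.sum]

theorem term_mem_normalForms {O : AddSubgroup A} {n : Fin e → ℤ} {i : ℕ} {a : A} (ha : a ∈ O)
    (hn : IsReducedExp kind n) (hi : ∀ j : Fin e, i ≤ j → n j = 0) :
    φ a * tpow t n ∈ normalForms φ O kind t i := by
  classical
  refine ⟨Finsupp.single n a, fun m => ?_, fun m hm => ?_, by simp⟩
  · rw [Finsupp.single_apply]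
    split_ifs
    exacts [ha, O.zero_mem]
  · rw [Finset.mem_singleton.1 (Finsupp.support_single_subset hm)]
    exact ⟨hn, hi⟩

/-- Normal forms over a subring are closed under products by `exists_reduced_mul`. `normalForms`
asks only for an additive subgroup so that it can also be used with proper fractions. -/
theorem mem_levelOver_iff (ht : Admissible kind t) {i : ℕ} {f : E} :
    f ∈ levelOver φ O kind t i ↔ f ∈ normalForms φ O.toAddSubgroup kind t i := by
  constructor
  · intro hf
    have term {a : A} (ha : a ∈ O) {n : Fin e → ℤ} (hn : IsReducedExp kind n)
        (hi : ∀ j : Fin e, i ≤ j → n j = 0) :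
        φ a * tpow t n ∈ normalForms φ O.toAddSubgroup kind t i :=
      term_mem_normalForms ha hn hi
    have base {a : A} (ha : a ∈ O) : φ a ∈ normalForms φ O.toAddSubgroup kind t i := by
      simpa using term ha (isReducedExp_zero ht) (by simp)
    induction hf using Subring.closure_induction with
    | mem y hy =>
      rcases hy with ⟨a, ha, rfl⟩ | ⟨j, hj, hy⟩
      · exact base ha
      · have hs (a : ℤ) (k : Fin e) (hk : i ≤ k) : (Pi.single j a : Fin e → ℤ) k = 0 := by
          rw [Pi.single_eq_of_ne]
          rintro rfl
          omega
        rcases hy with rfl | ⟨hk, hy⟩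
        · simpa [tpow_single] using term O.one_mem (isReducedExp_single ht j) (hs 1)
        · have h1 : ipow (t j) (-1) = y := by
            change (Ring.inverse (t j)) ^ 1 = y
            rw [pow_one, inverse_eq_of_mul_eq_one (by rw [mul_comm, hy])]
          have h2 : IsReducedExp kind (Pi.single j (-1)) := by
            intro k
            by_cases hkj : k = j
            · subst hkj
              rw [hk]
              trivial
            · have := isReducedExp_zero ht k
              simpa [Pi.single_eq_of_ne hkj] using this
          simpa [tpow_single, h1] using term O.one_mem h2 (hs (-1))
    | zero => exact AddSubgroup.zero_mem _
    | one => simpa using base O.one_mem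
    | add x y _ _ hx hy => exact AddSubgroup.add_mem _ hx hy
    | neg x _ hx => exact AddSubgroup.neg_mem _ hx
    | mul x y _ _ hx hy =>
      obtain ⟨c, hc, hc', rfl⟩ := hx
      obtain ⟨b, hb, hb', rfl⟩ := hy
      rw [Finsupp.sum_mul]
      refine AddSubgroup.sum_mem _ fun n hn => ?_
      beta_reduce
      rw [Finsupp.mul_sum]
      refine AddSubgroup.sum_mem _ fun m hm => ?_
      obtain ⟨l, hl, hl', hnm⟩ := exists_reduced_mul ht (hc' n hn).1 (hc' n hn).2
        (hb' m hm).1 (hb' m hm).2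
      beta_reduce
      rw [mul_mul_mul_comm, hnm, ← map_mul]
      exact term (O.mul_mem (hc n) (hb m)) hl hl'
  · rintro ⟨c, hc, hc', rfl⟩
    exact Subring.sum_mem _ fun n hn => Subring.mul_mem _ (map_mem_levelOver (hc n) i)
      (tpow_mem_levelOver ht (hc' n hn).1 (hc' n hn).2)

/-! ### Independence -/

/-- The members `v n` with `P n` are linearly independent over `B`. -/
def Indep {ι : Type*} (φ : A →+* E) (B : Subring A) (P : ι → Prop) (v : ι → E) : Prop :=
  ∀ (s : Finset ι), (∀ n ∈ s, P n) → ∀ c : ι → A, (∀ n ∈ s, c n ∈ B) →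
    ∑ n ∈ s, φ (c n) * v n = 0 → ∀ n ∈ s, c n = 0

/-- A relation is grouped by the second index: independence of `w` kills each group, and then
independence of `v` kills the coefficients. -/
theorem Indep.tower {H : Type*} [CommRing H] {ι κ : Type*} {B : Subring A} {P : ι → Prop}
    {v : ι → E} (h : Indep φ B P v) {χ : E →+* H} {B' : Subring E} {Q : κ → Prop} {w : κ → H}
    (h' : Indep χ B' Q w) (hB : ∀ a ∈ B, φ a ∈ B') (hv : ∀ n, P n → v n ∈ B') :
    Indep (χ.comp φ) B (fun x : ι × κ => P x.1 ∧ Q x.2) (fun x => χ (v x.1) * w x.2) := by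
  classical
  intro s hs c hc hsum
  have h1 : ∑ k ∈ s.image Prod.snd, χ (∑ x ∈ s with x.2 = k, φ (c x) * v x.1) * w k = 0 := by
    rw [← hsum, ← Finset.sum_fiberwise_of_maps_to (g := Prod.snd) (t := s.image Prod.snd)
      (fun x hx => Finset.mem_image_of_mem _ hx)]
    refine Finset.sum_congr rfl fun k _ => ?_
    rw [map_sum, Finset.sum_mul]
    refine Finset.sum_congr rfl fun x hx => ?_
    rw [← (Finset.mem_filter.1 hx).2]
    simp [mul_assoc]
  have h2 := h' _ (by
    intro k hk
    obtain ⟨x, hx, rfl⟩ := Finset.mem_image.1 hk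
    exact (hs x hx).2) (fun k => ∑ x ∈ s with x.2 = k, φ (c x) * v x.1) (by
    intro k _
    refine Subring.sum_mem _ fun x hx => ?_
    have hx := (Finset.mem_filter.1 hx).1
    exact Subring.mul_mem _ (hB _ (hc x hx)) (hv _ (hs x hx).1)) h1
  intro x hx
  have h3 := h2 x.2 (Finset.mem_image_of_mem _ hx)
  have h4 := h ((s.filter fun y => y.2 = x.2).image Prod.fst) (by
      intro n hn
      obtain ⟨y, hy, rfl⟩ := Finset.mem_image.1 hn
      exact (hs y (Finset.mem_filter.1 hy).1).1) (fun n => c (n, x.2)) (by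
      intro n hn
      obtain ⟨y, hy, rfl⟩ := Finset.mem_image.1 hn
      obtain ⟨hy, hyx⟩ := Finset.mem_filter.1 hy
      simp only [← hyx]
      exact hc y hy) (by
      rw [Finset.sum_image]
      · rw [← h3]
        refine Finset.sum_congr rfl fun y hy => ?_
        rw [← (Finset.mem_filter.1 hy).2]
      · intro y hy z hz hyz
        exact Prod.ext hyz ((Finset.mem_filter.1 hy).2.trans (Finset.mem_filter.1 hz).2.symm))
  exact h4 x.1 (Finset.mem_image.2 ⟨x, by simp [hx], rfl⟩)

/-- Serves to pass from exponents in `Fin ν` or `ℕ` to integers, and to split one entry off an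
exponent vector. Such maps are injective only on the admissible indices. -/
theorem Indep.comp {ι κ : Type*} {B : Subring A} {P : ι → Prop} {v : ι → E} (h : Indep φ B P v)
    (f : κ → ι) {Q : κ → Prop} {w : κ → E} (hf : Set.InjOn f {k | Q k}) (hQ : ∀ k, Q k → P (f k))
    (hw : ∀ k, Q k → w k = v (f k)) : Indep φ B Q w := by
  classical
  intro s hs c hc hsum
  have hinj : Set.InjOn f s := hf.mono fun k hk => hs k hk
  rcases s.eq_empty_or_nonempty with rfl | ⟨k₀, _⟩
  · simp
  have : Nonempty κ := ⟨k₀⟩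
  have hleft : ∀ k ∈ s, Function.invFunOn f s (f k) = k := fun k hk =>
    hinj.leftInvOn_invFunOn hk
  have := h (s.image f) (by
    intro n hn
    obtain ⟨k, hk, rfl⟩ := Finset.mem_image.1 hn
    exact hQ k (hs k hk)) (fun n => c (Function.invFunOn f s n)) (by
    intro n hn
    obtain ⟨k, hk, rfl⟩ := Finset.mem_image.1 hn
    simpa [hleft k hk] using hc k hk) (by
    rw [Finset.sum_image hinj, ← hsum]
    refine Finset.sum_congr rfl fun k hk => ?_
    rw [hleft k hk, hw k (hs k hk)])
  intro k hk
  simpa [hleft k hk] using this (f k) (Finset.mem_image_of_mem f hk)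

theorem Indep.finsupp_eq {ι : Type*} {P : ι → Prop} {v : ι → E} (h : Indep φ ⊤ P v)
    {c b : ι →₀ A} (hc : ∀ n ∈ c.support, P n) (hb : ∀ n ∈ b.support, P n)
    (heq : (c.sum fun n a => φ a * v n) = b.sum fun n a => φ a * v n) : c = b := by
  classical
  have := h (c.support ∪ b.support) (fun n hn => (Finset.mem_union.1 hn).elim (hc n) (hb n))
    (fun n => c n - b n) (fun _ _ => trivial) (by
      rw [Finsupp.sum_of_support_subset c (Finset.subset_union_left (s₂ := b.support)) _ (by simp),
        Finsupp.sum_of_support_subset b (Finset.subset_union_right (s₁ := c.support)) _ (by simp)]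
        at heq
      simp only [map_sub, sub_mul, Finset.sum_sub_distrib]
      rw [heq, sub_self])
  ext n
  by_cases hn : n ∈ c.support ∪ b.support
  · exact sub_eq_zero.1 (this n hn)
  · simp only [Finset.mem_union, Finsupp.mem_support_iff, not_or, not_not] at hn
    rw [hn.1, hn.2]

/-- The two coefficient families coincide by uniqueness, so one family meets both restrictions. -/
theorem mem_normalForms_inter (hind : Indep φ ⊤ (IsReducedExp kind) (tpow t)) {f : E}
    {O O' : AddSubgroup A} {i i' : ℕ} (h : f ∈ normalForms φ O kind t i)
    (h' : f ∈ normalForms φ O' kind t i') :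
    f ∈ normalForms φ (O ⊓ O') kind t i := by
  obtain ⟨c, hc, hc', rfl⟩ := h
  obtain ⟨b, hb, hb', heq⟩ := h'
  have := hind.finsupp_eq (fun n hn => (hc' n hn).1) (fun n hn => (hb' n hn).1) heq
  subst this
  exact ⟨c, fun n => ⟨hc n, hb n⟩, hc', rfl⟩

/-- The range of the exponents of a monomial of the given kind. -/
def Kind.expRange : Kind → ℤ → Prop
  | Kind.rootOfUnity ν, a => 0 ≤ a ∧ a < ν
  | Kind.prod, _ => True
  | Kind.sum, a => 0 ≤ a

theorem isReducedExp_iff {n : Fin e → ℤ} : IsReducedExp kind n ↔ ∀ j, (kind j).expRange (n j) := by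
  refine forall_congr' fun j => ?_
  cases kind j <;> rfl

theorem indep_of_linearIndependent {ι : Type*} {B : Subring E} {v : ι → E}
    (h : LinearIndependent B v) : Indep (RingHom.id E) B (fun _ => True) v := by
  classical
  intro s _ c hc hsum n hn
  have := linearIndependent_iff'.1 h s (fun n => if h : c n ∈ B then ⟨c n, h⟩ else 0) (by
    rw [← hsum]
    refine Finset.sum_congr rfl fun k hk => ?_
    rw [dif_pos (hc k hk)]
    rfl) n hn
  rw [dif_pos (hc n hn)] at this
  exact congrArg Subtype.val this

theorem indep_pow_of_transcendental {B : Subring E} {y : E} (h : Transcendental B y) :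
    Indep (RingHom.id E) B (fun _ => True) (fun k : ℕ => y ^ k) := by
  classical
  intro s _ c hc hsum n hn
  set b : ℕ → B := fun n => if h : c n ∈ B then ⟨c n, h⟩ else 0 with hb
  have hbc : ∀ k ∈ s, (b k : E) = c k := fun k hk => by rw [hb]; simp [hc k hk]
  have h0 : ∑ k ∈ s, monomial k (b k) = 0 := transcendental_iff.1 h _ (by
    rw [map_sum, ← hsum]
    refine Finset.sum_congr rfl fun k hk => ?_
    rw [aeval_monomial]
    change (b k : E) * _ = _
    rw [hbc k hk]
    rfl)
  have h1 := congrArg (fun p => coeff p n) h0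
  simp only [finsetSum_coeff, coeff_monomial, coeff_zero, Finset.sum_ite_eq', hn, if_true] at h1
  rw [← hbc n hn, h1]
  rfl

theorem IsMonomial.indep {σ : E ≃+* E} {B : Subring E} {y : E} {κ : Kind}
    (h : IsMonomial σ B y κ) :
    Indep (RingHom.id E) B κ.expRange (fun a : ℤ => ipow y a) := by
  cases κ with
  | rootOfUnity ν =>
    obtain ⟨hν, _, h, _⟩ := h
    refine (indep_of_linearIndependent h).comp
      (fun a => (⟨a.toNat % ν, Nat.mod_lt _ (by omega)⟩ : Fin ν)) ?_ (by simp) ?_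
    · rintro a ⟨ha, ha'⟩ b ⟨hb, hb'⟩ hab
      simp only [Fin.mk.injEq] at hab
      rw [Nat.mod_eq_of_lt (by omega), Nat.mod_eq_of_lt (by omega)] at hab
      omega
    · rintro a ⟨ha, ha'⟩
      obtain ⟨k, rfl⟩ := Int.eq_ofNat_of_zero_le ha
      rw [ipow_natCast]
      simp only [Int.toNat_natCast]
      rw [Nat.mod_eq_of_lt (by omega)]
  | prod =>
    exact (indep_of_linearIndependent h.2.1).comp id (Set.injOn_id _) (by simp) (by simp)
  | sum =>
    refine (indep_pow_of_transcendental h.1).comp Int.toNat ?_ (by simp) ?_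
    · intro a ha b hb hab
      have ha : 0 ≤ a := ha
      have hb : 0 ≤ b := hb
      omega
    · intro a ha
      obtain ⟨k, rfl⟩ := Int.eq_ofNat_of_zero_le ha
      rw [ipow_natCast, Int.toNat_natCast]

/-- Induction along the tower: an exponent vector is split into its entry at the newest monomial and
the rest, and `Indep.tower` applies. -/
theorem indep_of_isMonomial {σE : E ≃+* E} (hφ : Function.Injective φ) (ht : Admissible kind t)
    (h : ∀ i : Fin e, IsMonomial σE (level φ kind t i) (t i) (kind i)) :
    Indep φ ⊤ (IsReducedExp kind) (tpow t) := by
  have key : ∀ i : ℕ, i ≤ e → Indep φ ⊤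
      (fun n => IsReducedExp kind n ∧ ∀ j : Fin e, i ≤ j → n j = 0) (tpow t) := by
    intro i
    induction i with
    | zero =>
      intro _ s hs c _ hsum n hn
      have h0 : ∀ m ∈ s, m = 0 := fun m hm => funext fun j => (hs m hm).2 j (Nat.zero_le _)
      have hs' : s = {0} := by
        refine Finset.eq_singleton_iff_unique_mem.2 ⟨?_, h0⟩
        rw [← h0 n hn]
        exact hn
      rw [h0 n hn]
      rw [hs', Finset.sum_singleton, tpow_zero, mul_one] at hsum
      exact hφ (by rw [hsum, map_zero])
    | succ i ih =>
      intro hi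
      have h1 := (ih (by omega)).tower (h ⟨i, hi⟩).indep
        (fun a _ => by rw [level_eq_levelOver]; exact map_mem_levelOver (Subring.mem_top _) _)
        (fun n hn => by rw [level_eq_levelOver]; exact tpow_mem_levelOver ht hn.1 hn.2)
      refine Indep.comp h1 (fun n => (Function.update n ⟨i, hi⟩ 0, n ⟨i, hi⟩)) ?_ ?_ ?_
      · intro n _ m _ hnm
        obtain ⟨h2, h3⟩ := Prod.ext_iff.1 hnm
        simp only at h2 h3
        ext j
        by_cases hj : j = ⟨i, hi⟩
        · rw [hj, h3]
        · have := congrFun h2 j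
          rwa [Function.update_of_ne hj, Function.update_of_ne hj] at this
      · rintro n ⟨hn, hn'⟩
        refine ⟨⟨?_, ?_⟩, (isReducedExp_iff.1 hn) _⟩
        · rw [isReducedExp_iff] at hn ⊢
          intro j
          dsimp only
          by_cases hj : j = ⟨i, hi⟩
          · rw [hj, Function.update_self]
            exact (isReducedExp_iff.1 (isReducedExp_zero ht)) _
          · rw [Function.update_of_ne hj]
            exact hn j
        · intro j hj
          dsimp only
          by_cases hji : j = ⟨i, hi⟩
          · rw [hji, Function.update_self]
          · rw [Function.update_of_ne hji]
            refine hn' j ?_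
            have : (j : ℕ) ≠ i := fun h => hji (Fin.ext h)
            omega
      · intro n _
        exact tpow_update t n _
  exact (key e le_rfl).comp id (Set.injOn_id _)
    (fun n hn => ⟨hn, fun j hj => absurd j.2 (not_lt.2 hj)⟩) (fun _ _ => rfl)

theorem IsRPSExtension.indep {σA : A ≃+* A} {σE : E ≃+* E}
    (h : IsRPSExtension σA σE φ kind t) : Indep φ ⊤ (IsReducedExp kind) (tpow t) :=
  indep_of_isMonomial h.injective h.admissible h.monomial

end Generic

/-! ### Action of the automorphism on the levels of a tower -/

section Shift

variable {A : Type u} [CommRing A] {E : Type v} [CommRing E] {φ : A →+* E}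
  {e : ℕ} {kind : Fin e → Kind} {t : Fin e → E}

/-- The automorphism acts on the generators by means of units and elements of the levels
over `O`. -/
structure ShiftStable (σE : E ≃+* E) (φ : A →+* E) (O : Subring A) {e : ℕ} (kind : Fin e → Kind)
    (t : Fin e → E) : Prop where
  unit : ∀ i, kind i ≠ Kind.sum → ∃ v, UnitIn (levelOver φ O kind t i) v ∧ σE (t i) = v * t i
  sum : ∀ i, kind i = Kind.sum → σE (t i) - t i ∈ levelOver φ O kind t i

theorem ShiftStable.mono {σE : E ≃+* E} {O O' : Subring A} (h : ShiftStable σE φ O kind t)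
    (hO : O ≤ O') : ShiftStable σE φ O' kind t where
  unit i hi := by
    obtain ⟨v, hv, hv'⟩ := h.unit i hi
    exact ⟨v, hv.mono (levelOver_mono hO le_rfl), hv'⟩
  sum i hi := levelOver_mono hO le_rfl (h.sum i hi)

variable {σA : A ≃+* A} {σE : E ≃+* E} {O O' : Subring A}

theorem ShiftStable.map_mem (h : ShiftStable σE φ O' kind t) (ht : Admissible kind t)
    (hσ : ∀ a, σE (φ a) = φ (σA a)) (hO : ∀ a ∈ O, σA a ∈ O') {i : ℕ} {f : E}
    (hf : f ∈ levelOver φ O kind t i) : σE f ∈ levelOver φ O' kind t i := by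
  have hunit : ∀ j : Fin e, (j : ℕ) < i → kind j ≠ Kind.sum →
      UnitIn (levelOver φ O' kind t i) (σE (t j)) := by
    intro j hj hk
    obtain ⟨v, hv, hv'⟩ := h.unit j hk
    rw [hv']
    exact (hv.mono (levelOver_mono le_rfl hj.le)).mul (unitIn_gen ht hj hk)
  refine (levelOver_le (L := (levelOver φ O' kind t i).comap (σE : E →+* E)) ?_ ?_ ?_) hf
  · intro a ha
    change σE (φ a) ∈ levelOver φ O' kind t i
    rw [hσ]
    exact map_mem_levelOver (hO a ha) i
  · intro j hj
    change σE (t j) ∈ levelOver φ O' kind t i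
    by_cases hk : kind j = Kind.sum
    · have h1 := levelOver_mono le_rfl hj.le (h.sum j hk)
      simpa using Subring.add_mem _ h1 (gen_mem_levelOver hj)
    · exact (hunit j hj hk).1
  · intro j hj hk y hy
    change σE y ∈ levelOver φ O' kind t i
    refine (hunit j hj (by simp [hk])).mem_of_mul_eq_one ?_
    rw [← map_mul, hy, map_one]

/-- From `σ t = v t` follows `σ⁻¹ t = (σ⁻¹ v)⁻¹ t`, and from `σ t = t + β` follows `σ⁻¹ t = t - σ⁻¹
β`. Since `v` and `β` lie at the level strictly below `t`, strong induction on the level controls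
their preimages. -/
theorem ShiftStable.symm_map_mem (h : ShiftStable σE φ O' kind t) (ht : Admissible kind t)
    (hσ : ∀ a, σE (φ a) = φ (σA a)) (hO : ∀ a ∈ O', σA.symm a ∈ O) {i : ℕ} {f : E}
    (hf : f ∈ levelOver φ O' kind t i) : σE.symm f ∈ levelOver φ O kind t i := by
  induction i using Nat.strong_induction_on generalizing f with
  | _ i ih =>
    have hunit : ∀ j : Fin e, (j : ℕ) < i → kind j ≠ Kind.sum →
        UnitIn (levelOver φ O kind t i) (σE.symm (t j)) := by
      intro j hj hk
      obtain ⟨v, hv, hv'⟩ := h.unit j hk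
      have h1 : UnitIn (levelOver φ O kind t i) (σE.symm v) :=
        (hv.map (σE.symm : E →+* E) fun x hx => ih j hj hx).mono (levelOver_mono le_rfl hj.le)
      have h2 : t j = σE.symm v * σE.symm (t j) := by
        rw [← map_mul, ← hv', RingEquiv.symm_apply_apply]
      obtain ⟨hv1, w, hw, hvw⟩ := h1
      have h3 : σE.symm (t j) = w * t j := by
        conv_rhs => rw [h2, ← mul_assoc, mul_comm w, hvw, one_mul]
      rw [h3]
      exact UnitIn.mul ⟨hw, σE.symm v, hv1, by rw [mul_comm, hvw]⟩ (unitIn_gen ht hj hk)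
    refine (levelOver_le (L := (levelOver φ O kind t i).comap (σE.symm : E →+* E)) ?_ ?_ ?_) hf
    · intro a ha
      change σE.symm (φ a) ∈ levelOver φ O kind t i
      have : σE.symm (φ a) = φ (σA.symm a) := by
        rw [RingEquiv.symm_apply_eq, hσ, RingEquiv.apply_symm_apply]
      rw [this]
      exact map_mem_levelOver (hO a ha) i
    · intro j hj
      change σE.symm (t j) ∈ levelOver φ O kind t i
      by_cases hk : kind j = Kind.sum
      · have h1 := levelOver_mono le_rfl hj.le (ih j hj (h.sum j hk))
        rw [map_sub, RingEquiv.symm_apply_apply] at h1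
        simpa using Subring.sub_mem _ (gen_mem_levelOver hj) h1
      · exact (hunit j hj hk).1
    · intro j hj hk y hy
      change σE.symm y ∈ levelOver φ O kind t i
      refine (hunit j hj (by simp [hk])).mem_of_mul_eq_one ?_
      rw [← map_mul, hy, map_one]

/-- An element is built from finitely many coefficients by ring operations, and a filter is closed
under finite intersections. -/
theorem eventually_mem_levelOver {κ : Type*} {l : Filter κ} {B : Subring A} {C : κ → Subring A}
    (h : ∀ a ∈ B, ∀ᶠ k in l, a ∈ C k) {i : ℕ} {f : E} (hf : f ∈ levelOver φ B kind t i) :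
    ∀ᶠ k in l, f ∈ levelOver φ (C k) kind t i := by
  induction hf using Subring.closure_induction with
  | mem y hy =>
    rcases hy with ⟨a, ha, rfl⟩ | ⟨j, hj, rfl | ⟨hk, hy⟩⟩
    · exact (h a ha).mono fun k hk => map_mem_levelOver hk i
    · exact Filter.Eventually.of_forall fun k => gen_mem_levelOver hj
    · exact Filter.Eventually.of_forall fun k => inv_mem_levelOver hj hk hy
  | zero => exact Filter.Eventually.of_forall fun k => Subring.zero_mem _
  | one => exact Filter.Eventually.of_forall fun k => Subring.one_mem _
  | add x y _ _ hx hy => filter_upwards [hx, hy] with k hx hy using Subring.add_mem _ hx hy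
  | neg x _ hx => exact hx.mono fun k hx => Subring.neg_mem _ hx
  | mul x y _ _ hx hy => filter_upwards [hx, hy] with k hx hy using Subring.mul_mem _ hx hy

end Shift

/-! ### Polynomials in a Σ-monomial -/

section SigmaMonomial

variable {R : Type u} [CommRing R]

/-- This Taylor coefficient is the value at `β` of the Hasse derivative of order `m`, which has
degree at most 1 here. It shows how `β` enters the second highest coefficient. -/
theorem coeff_taylor_of_natDegree_le {p : R[X]} {m : ℕ} (hp : p.natDegree ≤ m + 1) (β : R) :
    (taylor β p).coeff m = p.coeff m + (m + 1) * p.coeff (m + 1) * β := by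
  have h1 : (hasseDeriv m p).natDegree ≤ 1 := (natDegree_hasseDeriv_le p m).trans (by omega)
  rw [taylor_coeff, eq_X_add_C_of_natDegree_le_one h1]
  simp [hasseDeriv_coeff, add_comm 1 m, Nat.choose_succ_self_right]
  ring

theorem coeff_taylor_of_natDegree_le' {p : R[X]} {m : ℕ} (hp : p.natDegree ≤ m) (β : R) :
    (taylor β p).coeff m = p.coeff m := by
  rw [coeff_taylor_of_natDegree_le (hp.trans (Nat.le_succ m)),
    coeff_eq_zero_of_natDegree_lt (Nat.lt_succ_of_le hp)]
  ring

theorem coeff_taylor_mem {B : Subring R} {p : R[X]} (hp : ∀ n, p.coeff n ∈ B) {β : R}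
    (hβ : β ∈ B) (n : ℕ) : (taylor β p).coeff n ∈ B := by
  rw [taylor_coeff, eval_eq_sum_range]
  refine Subring.sum_mem _ fun k _ => Subring.mul_mem _ ?_ (Subring.pow_mem _ hβ k)
  rw [hasseDeriv_coeff]
  exact Subring.mul_mem _ (natCast_mem B _) (hp _)

/-- `y` is transcendental over the subring `B`. -/
def TranscendentalOver (B : Subring R) (y : R) : Prop :=
  ∀ q : R[X], (∀ n, q.coeff n ∈ B) → q.eval y = 0 → q = 0

/-- Suppose `q` has degree `n ≥ 2` and top coefficients `a`, `b`. Above degree 0 the coefficients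
must agree, so `σ a = a` and `σ b + n a β = b`. Then `n a y + b` is a constant, hence in `B`,
against the transcendence of `y`. -/
theorem exists_linear_of_map_sub_mem {σ : R ≃+* R} {B : Subring R} (hσ : ∀ b ∈ B, σ b ∈ B)
    (hconst : ∀ c, σ c = c → c ∈ B) (hchar : ∀ m : ℕ, m ≠ 0 → ∀ x : R, m * x = 0 → x = 0)
    {y β : R} (hβ : β ∈ B) (hy : σ y = y + β) (htr : TranscendentalOver B y) {q : R[X]}
    (hq : ∀ n, q.coeff n ∈ B) (hqB : σ (q.eval y) - q.eval y ∈ B) :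
    ∃ c b, σ c = c ∧ b ∈ B ∧ q.eval y = c * y + b := by
  set q' := q.map (σ : R →+* R) with hq'
  have hcoeff : ∀ n, q'.coeff n = σ (q.coeff n) := fun n => by simp [hq']
  have hdeg : q'.natDegree = q.natDegree := natDegree_map_eq_of_injective σ.injective q
  have heval : σ (q.eval y) = (taylor β q').eval y := by
    rw [taylor_eval, hq', ← hy]
    exact (eval_map_apply (σ : R →+* R) y).symm
  -- `σ (q(y))` is the value at `y` of the Taylor shift of the twisted polynomial, so transcendence
  -- turns `hqB` into an identity of polynomials.
  have h0 : taylor β q' - q - C (σ (q.eval y) - q.eval y) = 0 := by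
    refine htr _ (fun n => ?_) ?_
    · rw [coeff_sub, coeff_sub, coeff_C]
      refine B.sub_mem (B.sub_mem (coeff_taylor_mem (fun n => ?_) hβ n) (hq n)) ?_
      · rw [hcoeff]
        exact hσ _ (hq n)
      · split_ifs
        exacts [hqB, B.zero_mem]
    · rw [eval_sub, eval_sub, eval_C, heval, sub_self]
  have h1 : ∀ n, n ≠ 0 → (taylor β q').coeff n = q.coeff n := by
    intro n hn
    have := congrArg (fun p => coeff p n) h0
    simpa [coeff_C, hn, sub_eq_zero] using this
  have hle : q.natDegree ≤ 1 := by
    by_contra! hlt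
    obtain ⟨m, hm⟩ := Nat.exists_eq_add_of_le hlt
    have hm : q.natDegree = m + 1 + 1 := by omega
    have hlead : σ (q.coeff (m + 1 + 1)) = q.coeff (m + 1 + 1) := by
      rw [← hcoeff, ← h1 _ (by omega), coeff_taylor_of_natDegree_le' (by omega)]
    have hsec := h1 (m + 1) (by omega)
    rw [coeff_taylor_of_natDegree_le (by omega), hcoeff, hcoeff, hlead] at hsec
    set a := q.coeff (m + 1 + 1) with ha
    set b := q.coeff (m + 1) with hb
    have hz : σ (((m + 1 + 1 : ℕ) : R) * a * y + b) = ((m + 1 + 1 : ℕ) : R) * a * y + b := by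
      rw [map_add, map_mul, map_mul, hlead, hy, map_natCast]
      push_cast at hsec ⊢
      linear_combination hsec
    -- The constant just found lies in `B`, so this linear polynomial over `B` has the root `y`.
    have h2 := htr (C (((m + 1 + 1 : ℕ) : R) * a) * X +
        C (b - (((m + 1 + 1 : ℕ) : R) * a * y + b))) (fun n => by
      simp only [coeff_add, coeff_C_mul, coeff_X, coeff_C]
      refine B.add_mem (B.mul_mem (B.mul_mem (natCast_mem B _) (hq _)) ?_) ?_
      · split_ifs
        exacts [B.one_mem, B.zero_mem]
      · split_ifs
        exacts [B.sub_mem (hq _) (hconst _ hz), B.zero_mem]) (by simp)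
    have h3 := congrArg (fun p => coeff p 1) h2
    simp only [coeff_add, coeff_C_mul, coeff_X_one, mul_one, coeff_C_succ, coeff_zero,
      add_zero] at h3
    have h4 := hchar _ (by omega) _ h3
    rw [ha, ← hm] at h4
    have h5 := leadingCoeff_eq_zero.1 h4
    rw [h5] at hm
    simp at hm
  refine ⟨q.coeff 1, q.coeff 0, ?_, hq 0, ?_⟩
  · rw [← hcoeff, ← h1 1 one_ne_zero, coeff_taylor_of_natDegree_le' (by omega)]
  · conv_lhs => rw [eq_X_add_C_of_natDegree_le_one hle]
    simp

/-- An invariant polynomial of degree `n ≥ 1` with top coefficients `a`, `b` would give `σ a = a`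
and `σ b + n a β = b`. As `n a` has a constant inverse, `-b / (n a)` would then telescope `β`. -/
theorem eq_C_of_polyShift_eq {σ : R ≃+* R} {β : R}
    (hfield : ∀ c : R, σ c = c → c ≠ 0 → ∀ m : ℕ, m ≠ 0 → ∃ c', σ c' = c' ∧ m * c * c' = 1)
    (hβ : ¬ ∃ γ, σ γ - γ = β) {p : R[X]} (hp : polyShift σ β p = p) :
    ∃ a, σ a = a ∧ C a = p := by
  have hshift : polyShift σ β p = taylor β (p.map (σ : R →+* R)) := by
    simp [polyShift, taylor_apply]
    rfl
  rw [hshift] at hp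
  have hdeg : (p.map (σ : R →+* R)).natDegree = p.natDegree :=
    natDegree_map_eq_of_injective σ.injective p
  have hlead : σ (p.coeff p.natDegree) = p.coeff p.natDegree := by
    have := coeff_taylor_of_natDegree_le' hdeg.le β
    rw [hp, coeff_map] at this
    exact this.symm
  rcases Nat.eq_zero_or_pos p.natDegree with h0 | hpos
  · rw [h0] at hlead
    exact ⟨p.coeff 0, hlead, (eq_C_of_natDegree_eq_zero h0).symm⟩
  · obtain ⟨m, hm⟩ := Nat.exists_eq_add_of_lt hpos
    have hm : p.natDegree = m + 1 := by omega
    have hne : p.coeff p.natDegree ≠ 0 := by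
      intro h
      have := leadingCoeff_eq_zero.1 h
      rw [this] at hm
      simp at hm
    have hsec : (taylor β (p.map (σ : R →+* R))).coeff m = p.coeff m := by rw [hp]
    rw [coeff_taylor_of_natDegree_le (by omega), coeff_map, coeff_map] at hsec
    change σ _ + _ * σ _ * _ = _ at hsec
    rw [hm] at hlead hne
    rw [hlead] at hsec
    obtain ⟨c', hc', hcc⟩ := hfield _ hlead hne (m + 1) (by omega)
    refine absurd ⟨-(c' * p.coeff m), ?_⟩ hβ
    rw [map_neg, map_mul, hc']
    push_cast at hcc
    linear_combination (-c') * hsec + β * hcc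

end SigmaMonomial

/-! ### Solutions are linear in the `Q`-contributions -/

section Structure

variable {E : Type u} [CommRing E] {S : Type v} [CommRing S] {H : Type w} [CommRing H]
  {σE : E ≃+* E} {σS : S ≃+* S} {σH : H ≃+* H} {ψ : E →+* S} {ι : S →+* H} {r k : ℕ}
  {s : Fin r → S} {kindH : Fin k → Kind} {τ : Fin k → H}

/-- Allows the monomials to be reordered: `y`, adjoined before the `τ`, can be treated as adjoined
after them. The products of its powers with reduced power products in the `τ` are independent over
`S₀`. -/
theorem transcendentalOver_levelOver {S₀ : Subring S} {y : S} (hy : Transcendental S₀ y)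
    (hτ : Admissible kindH τ) (hind : Indep ι ⊤ (IsReducedExp kindH) (tpow τ)) (i : ℕ) :
    TranscendentalOver (levelOver ι S₀ kindH τ i) (ι y) := by
  classical
  intro q hq h0
  have h1 := (indep_pow_of_transcendental hy).tower hind (fun _ _ => Subring.mem_top _)
    (fun _ _ => Subring.mem_top _)
  have hq' := fun n => (mem_levelOver_iff hτ).1 (hq n)
  choose c hc hc' hsum using hq'
  set N := q.support.biUnion fun n => (c n).support with hN
  have h2 := h1 (q.support ×ˢ N) (by
      rintro ⟨n, m⟩ hnm
      obtain ⟨l, -, hl⟩ := Finset.mem_biUnion.1 (Finset.mem_product.1 hnm).2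
      exact ⟨trivial, (hc' l m hl).1⟩) (fun x => c x.1 x.2) (fun x _ => hc _ _) (by
      rw [Finset.sum_product, ← h0, eval_eq_sum, Polynomial.sum]
      refine Finset.sum_congr rfl fun n hn => ?_
      conv_rhs => rw [hsum n]
      rw [Finsupp.sum_of_support_subset (c n) (s := N)
        (Finset.subset_biUnion_of_mem (fun n => (c n).support) hn) _ (by simp), Finset.sum_mul]
      refine Finset.sum_congr rfl fun m _ => ?_
      simp
      ring)
  ext n
  by_cases hn : n ∈ q.support
  · rw [hsum n, coeff_zero]
    refine Finset.sum_eq_zero fun m hm => ?_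
    have := h2 (n, m) (Finset.mem_product.2 ⟨hn, Finset.mem_biUnion.2 ⟨n, hn, hm⟩⟩)
    simp only at this
    rw [this]
    simp
  · simpa using hn

/-- The values at the last Σ-monomial of polynomials over the smaller ring form a subring containing
all generators. A Σ-monomial contributes no inverse. -/
theorem exists_eval_of_mem_levelOver {i : ℕ} (hi : i < r) {h : H}
    (hh : h ∈ levelOver ι (level ψ (fun _ => Kind.sum) s (i + 1)) kindH τ k) :
    ∃ q : H[X], (∀ n, q.coeff n ∈ levelOver ι (level ψ (fun _ => Kind.sum) s i) kindH τ k) ∧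
      q.eval (ι (s ⟨i, hi⟩)) = h := by
  set B := levelOver ι (level ψ (fun _ => Kind.sum) s i) kindH τ k with hB
  set L := ((evalRingHom (ι (s ⟨i, hi⟩))).comp (mapRingHom B.subtype)).range with hL
  have hBL : B ≤ L := fun b hb => ⟨C ⟨b, hb⟩, by simp⟩
  suffices h ∈ L by
    obtain ⟨p, rfl⟩ := this
    exact ⟨p.map B.subtype, fun n => by simp, rfl⟩
  refine levelOver_le ?_ ?_ ?_ hh
  · intro a ha
    rw [level_eq_levelOver] at ha
    refine (levelOver_le (L := L.comap ι) ?_ ?_ ?_) ha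
    · intro a ha
      refine hBL (map_mem_levelOver ?_ _)
      rw [level_eq_levelOver]
      exact map_mem_levelOver ha _
    · intro j hj
      rcases Nat.lt_succ_iff_lt_or_eq.1 hj with hj | hj
      · refine hBL (map_mem_levelOver ?_ _)
        rw [level_eq_levelOver]
        exact gen_mem_levelOver hj
      · have : j = ⟨i, hi⟩ := Fin.ext hj
        rw [this]
        exact ⟨X, by simp⟩
    · intro j _ hj
      cases hj
  · exact fun j hj => hBL (gen_mem_levelOver hj)
  · exact fun j hj hk y hy => hBL (inv_mem_levelOver hj hk hy)

theorem level_zero_eq_range {e : ℕ} {kind : Fin e → Kind} {t : Fin e → S} :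
    level ψ kind t 0 = ψ.range := by
  simp [level]
  exact Subring.closure_eq ψ.range

/-- The `sᵢ` are stripped off from the last to the first by `exists_linear_of_map_sub_mem`. Removing
`c sᵢ` keeps the difference free of all `s`, because `σ(sᵢ) - sᵢ` comes from `E`. -/
theorem exists_linear_of_shift_sub_mem (hS : IsRPSExtension σE σS ψ (fun _ => Kind.sum) s)
    (hs : ∀ j, σS (s j) - s j ∈ ψ.range) (hH : IsRPSExtension σS σH ι kindH τ)
    (hstab : ShiftStable σH ι ψ.range kindH τ)
    (hchar : ∀ m : ℕ, m ≠ 0 → ∀ x : H, m * x = 0 → x = 0)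
    (hconst : ∀ c, σH c = c → c ∈ level (ι.comp ψ) kindH τ k) {h : H}
    (hh : σH h - h ∈ level (ι.comp ψ) kindH τ k) :
    ∃ c : Fin r → H, (∀ j, σH (c j) = c j) ∧
      ∃ e' ∈ level (ι.comp ψ) kindH τ k, h = ∑ j, c j * ι (s j) + e' := by
  rw [level_comp_eq_levelOver] at hconst hh ⊢
  set S₀ := level ψ (fun _ => Kind.sum) s with hS₀
  have hmono : ∀ i, ψ.range ≤ S₀ i := by
    rintro i _ ⟨a, rfl⟩
    rw [hS₀, level_eq_levelOver]
    exact map_mem_levelOver (Subring.mem_top _) i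
  have hstabS : ShiftStable σS ψ ⊤ (fun _ => Kind.sum) s :=
    ⟨fun i hi => absurd rfl hi, fun i _ => by
      obtain ⟨a, ha⟩ := hs i
      rw [← ha]
      exact map_mem_levelOver (Subring.mem_top _) _⟩
  have hσ : ∀ i, ∀ f ∈ levelOver ι (S₀ i) kindH τ k, σH f ∈ levelOver ι (S₀ i) kindH τ k := by
    intro i f hf
    refine (hstab.mono (hmono i)).map_mem hH.admissible hH.extends_base (fun a ha => ?_) hf
    rw [hS₀, level_eq_levelOver] at ha ⊢
    exact hstabS.map_mem hS.admissible hS.extends_base (fun _ _ => Subring.mem_top _) ha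
  have key : ∀ i ≤ r, ∀ h ∈ levelOver ι (S₀ i) kindH τ k,
      σH h - h ∈ levelOver ι ψ.range kindH τ k → ∃ c : Fin r → H, (∀ j, σH (c j) = c j) ∧
        ∃ e' ∈ levelOver ι ψ.range kindH τ k, h = ∑ j, c j * ι (s j) + e' := by
    intro i
    induction i with
    | zero =>
      intro _ h hh _
      rw [hS₀, level_zero_eq_range] at hh
      exact ⟨0, by simp, h, hh, by simp⟩
    | succ i ih =>
      intro hi h hh hσh
      obtain ⟨q, hq, rfl⟩ := exists_eval_of_mem_levelOver (i := i) hi hh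
      obtain ⟨y, hy⟩ := hs ⟨i, hi⟩
      have hy' : σH (ι (s ⟨i, hi⟩)) = ι (s ⟨i, hi⟩) + ι (ψ y) := by
        rw [hH.extends_base, hy, ← map_add, add_sub_cancel]
      have hyB : ι (ψ y) ∈ levelOver ι ψ.range kindH τ k :=
        map_mem_levelOver (RingHom.mem_range.2 ⟨y, rfl⟩) k
      have hle := levelOver_mono (φ := ι) (kind := kindH) (t := τ) (hmono i) (le_refl k)
      obtain ⟨c, b, hc, hb, heq⟩ := exists_linear_of_map_sub_mem (hσ i)
        (fun c hc => hle (hconst c hc)) hchar (hle hyB) hy'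
        (transcendentalOver_levelOver (hS.monomial ⟨i, hi⟩).1 hH.admissible hH.indep k) hq
        (hle hσh)
      rw [heq] at hσh ⊢
      obtain ⟨c', hc', e', he', rfl⟩ := ih (by omega) b hb (by
        have := Subring.sub_mem _ hσh (Subring.mul_mem _ (hconst c hc) hyB)
        convert this using 1
        rw [map_add, map_mul, hc, hy']
        ring)
      refine ⟨c' + Pi.single ⟨i, hi⟩ c, fun j => ?_, e', he', ?_⟩
      · rw [Pi.add_apply, map_add, hc']
        by_cases hj : j = ⟨i, hi⟩
        · subst hj
          simp [hc]
        · simp [Pi.single_eq_of_ne hj]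
      · simp only [Pi.add_apply, add_mul, Finset.sum_add_distrib]
        rw [Finset.sum_eq_single (f := fun j => (Pi.single ⟨i, hi⟩ c : Fin r → H) j * ι (s j))
          ⟨i, hi⟩ (fun j _ hj => by simp [Pi.single_eq_of_ne hj]) (by simp)]
        simp
        ring
  refine key r le_rfl h ?_ hh
  rw [hS₀, hS.generate, ← level_eq_levelOver, hH.generate]
  exact Subring.mem_top _

end Structure

/-! ### Shifts of polynomials and their poles -/

section RationalFunctions

variable {F : Type u} [Field F]

theorem algebraMap_polynomial_injective : Function.Injective (algebraMap F[X] (RatFunc F)) :=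
  IsFractionRing.injective F[X] (RatFunc F)

theorem algebraMap_polynomial_ne_zero {f : F[X]} (hf : f ≠ 0) :
    algebraMap F[X] (RatFunc F) f ≠ 0 :=
  (map_ne_zero_iff _ algebraMap_polynomial_injective).2 hf

theorem ne_zero_of_not_dvd {f g : F[X]} (h : ¬ f ∣ g) : g ≠ 0 :=
  fun hg => h (hg ▸ dvd_zero f)

theorem shift_zero (σ : RatFunc F ≃+* RatFunc F) (h : RatFunc F) : shift σ 0 h = h := by
  simp [shift]

theorem shift_add (σ : RatFunc F ≃+* RatFunc F) (k l : ℤ) (h : RatFunc F) :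
    shift σ (k + l) h = shift σ k (shift σ l h) := by
  simp [shift, zpow_add]

theorem shift_one (σ : RatFunc F ≃+* RatFunc F) (h : RatFunc F) : shift σ 1 h = σ h := by
  simp [shift]

theorem shift_map_div (σ : RatFunc F ≃+* RatFunc F) (k : ℤ) (f g : RatFunc F) :
    shift σ k (f / g) = shift σ k f / shift σ k g :=
  map_div₀ ((show RingAut (RatFunc F) from σ) ^ k : RingAut (RatFunc F)) f g

/-- The automorphisms of `F(x)` that restrict to degree preserving automorphisms of `F[x]`. -/
def polyAuts (F : Type u) [Field F] : Subgroup (RingAut (RatFunc F)) where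
  carrier := {ρ | ∃ P : F[X] ≃+* F[X],
    (∀ f, ρ (algebraMap F[X] (RatFunc F) f) = algebraMap F[X] (RatFunc F) (P f)) ∧
    ∀ f, (P f).natDegree = f.natDegree}
  one_mem' := ⟨RingEquiv.refl _, fun _ => rfl, fun _ => rfl⟩
  mul_mem' := by
    rintro ρ ρ' ⟨P, hP, hP'⟩ ⟨R, hR, hR'⟩
    refine ⟨R.trans P, fun f => ?_, fun f => ?_⟩
    · rw [RingAut.mul_apply, hR, hP]
      rfl
    · rw [RingEquiv.trans_apply, hP', hR']
  inv_mem' := by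
    rintro ρ ⟨P, hP, hP'⟩
    refine ⟨P.symm, fun f => ?_, fun f => ?_⟩
    · refine ρ.injective ?_
      rw [hP, P.apply_symm_apply]
      exact ρ.apply_symm_apply _
    · rw [← hP', P.apply_symm_apply]

theorem IsPiSigmaFieldExt.exists_linear {σF : F ≃+* F} {σ : RatFunc F ≃+* RatFunc F}
    (h : IsPiSigmaFieldExt σF σ) :
    ∃ a b : F, a ≠ 0 ∧ σ RatFunc.X = RatFunc.C a * RatFunc.X + RatFunc.C b := by
  rcases h.monomial with ⟨a, ha, h⟩ | ⟨b, h⟩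
  · exact ⟨a, 0, ha, by simp [h]⟩
  · exact ⟨1, b, one_ne_zero, by simp [h]⟩

theorem IsPiSigmaFieldExt.mem_polyAuts {σF : F ≃+* F} {σ : RatFunc F ≃+* RatFunc F}
    (h : IsPiSigmaFieldExt σF σ) : σ ∈ polyAuts F := by
  obtain ⟨a, b, ha, hX⟩ := h.exists_linear
  let _ := invertibleOfNonzero ha
  have hP : ∀ f, ((mapEquiv σF).trans (algEquivCMulXAddC a b).toRingEquiv) f =
      (f.map (σF : F →+* F)).comp (C a * X + C b) := by
    intro f
    simp [aeval_def, comp, algEquivCMulXAddC]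
  refine ⟨(mapEquiv σF).trans (algEquivCMulXAddC a b).toRingEquiv, fun f => ?_, fun f => ?_⟩
  · rw [hP]
    have : (σ : RatFunc F →+* RatFunc F).comp (algebraMap F[X] (RatFunc F)) =
        (algebraMap F[X] (RatFunc F)).comp ((compRingHom (C a * X + C b)).comp
          (mapRingHom (σF : F →+* F))) := by
      refine ringHom_ext (fun c => ?_) ?_
      · simp [RatFunc.algebraMap_C, h.extends_base]
      · simp [RatFunc.algebraMap_X, RatFunc.algebraMap_C, hX]
    exact RingHom.congr_fun this f
  · rw [hP, natDegree_comp, natDegree_linear ha, mul_one]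
    exact natDegree_map_eq_of_injective σF.injective f

/-- `P k` is the restriction of `σ ^ k` to `F[x]`. -/
structure PolyShifts (σ : RatFunc F ≃+* RatFunc F) (P : ℤ → F[X] ≃+* F[X]) : Prop where
  shift_eq : ∀ k f, shift σ k (algebraMap F[X] (RatFunc F) f) =
    algebraMap F[X] (RatFunc F) (P k f)
  natDegree_eq : ∀ k f, (P k f).natDegree = f.natDegree

/-- The automorphisms in `polyAuts` form a subgroup, so negative powers of `σ` need no separate
treatment. -/
theorem IsPiSigmaFieldExt.exists_polyShifts {σF : F ≃+* F} {σ : RatFunc F ≃+* RatFunc F}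
    (h : IsPiSigmaFieldExt σF σ) : ∃ P, PolyShifts σ P := by
  choose P hP hP' using fun k : ℤ => (polyAuts F).zpow_mem h.mem_polyAuts k
  exact ⟨P, hP, hP'⟩

variable {σ : RatFunc F ≃+* RatFunc F} {P : ℤ → F[X] ≃+* F[X]} {q : F[X]}

theorem PolyShifts.add_apply (hP : PolyShifts σ P) (k l : ℤ) (f : F[X]) :
    P (k + l) f = P k (P l f) := by
  apply algebraMap_polynomial_injective
  rw [← hP.shift_eq, shift_add, hP.shift_eq, hP.shift_eq]

theorem PolyShifts.zero_apply (hP : PolyShifts σ P) (f : F[X]) : P 0 f = f := by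
  apply algebraMap_polynomial_injective
  rw [← hP.shift_eq, shift_zero]

theorem PolyShifts.neg_apply_dvd (hP : PolyShifts σ P) {k : ℤ} {f g : F[X]}
    (h : f ∣ P (-k) g) : P k f ∣ g := by
  have := map_dvd (P k) h
  rwa [← hP.add_apply, add_neg_cancel, hP.zero_apply] at this

theorem PolyShifts.shift_C (hP : PolyShifts σ P) (k : ℤ) (a : F) :
    ∃ b, shift σ k (RatFunc.C a) = RatFunc.C b := by
  have h1 : (P k (C a)).natDegree = 0 := by rw [hP.natDegree_eq, natDegree_C]
  refine ⟨(P k (C a)).coeff 0, ?_⟩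
  rw [← RatFunc.algebraMap_C, hP.shift_eq, eq_C_of_natDegree_eq_zero h1, RatFunc.algebraMap_C]
  simp

/-- `period` looks at positive powers only. For a negative power, the quotient is shifted back and
inverted. -/
theorem PolyShifts.shift_div_ne (hP : PolyShifts σ P) {h : RatFunc F} (hper : period σ h = 0)
    {k : ℤ} (hk : k ≠ 0) (c : F) : shift σ k h / h ≠ RatFunc.C c := by
  have hpos : ∀ n : ℕ, 0 < n → ∀ c : F, shift σ n h / h ≠ RatFunc.C c := by
    intro n hn c hc
    -- An infimum `0` in `ℕ` means that `0` is in the set, which `0 < n` excludes, or that the set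
    -- is empty.
    rcases Nat.sInf_eq_zero.1 hper with h0 | h0
    · exact absurd h0.1 (lt_irrefl 0)
    · have : n ∈ {n : ℕ | 0 < n ∧ ∃ c : F, shift σ n h / h = RatFunc.C c} := ⟨hn, c, hc⟩
      rw [h0] at this
      exact this
  rcases Int.eq_nat_or_neg k with ⟨n, rfl | rfl⟩
  · exact hpos n (by omega) c
  · intro hc
    obtain ⟨b, hb⟩ := hP.shift_C n c
    refine hpos n (by omega) b⁻¹ ?_
    rw [map_inv₀, ← hb, ← hc, shift_map_div, ← shift_add, add_neg_cancel, shift_zero, inv_div]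

theorem PolyShifts.period_eq_zero (hP : PolyShifts σ P) {h : F[X]}
    (hper : period σ (algebraMap F[X] (RatFunc F) h) = 0) (k : ℤ) :
    period σ (algebraMap F[X] (RatFunc F) (P k h)) = 0 := by
  refine Nat.sInf_eq_zero.2 (Or.inr (Set.eq_empty_iff_forall_notMem.2 ?_))
  rintro n ⟨hn, c, hc⟩
  obtain ⟨b, hb⟩ := hP.shift_C (-k) c
  refine hP.shift_div_ne hper (k := n) (by omega) b ?_
  rw [← hb, ← hc, shift_map_div, ← hP.shift_eq, ← shift_add, ← shift_add, ← shift_add,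
    neg_add_cancel, shift_zero]
  congr 2
  ring

theorem exists_C_of_associated {f g : F[X]} (h : Associated f g) (hg : g ≠ 0) :
    ∃ c : F, algebraMap F[X] (RatFunc F) f / algebraMap F[X] (RatFunc F) g = RatFunc.C c := by
  obtain ⟨v, hv⟩ := h.symm
  obtain ⟨c, _, hc⟩ := Polynomial.isUnit_iff.1 v.isUnit
  refine ⟨c, ?_⟩
  rw [← hv, ← hc, map_mul, RatFunc.algebraMap_C, mul_div_cancel_left₀]
  exact algebraMap_polynomial_ne_zero hg

/-- Associated shifts would put a nontrivial shift quotient of `q` into `F`, against period 0. So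
the orbit of `q` is infinite up to units. -/
theorem PolyShifts.eq_of_associated (hP : PolyShifts σ P) (hq : q ≠ 0)
    (hper : period σ (algebraMap F[X] (RatFunc F) q) = 0) {k l : ℤ}
    (h : Associated (P k q) (P l q)) : k = l := by
  by_contra hkl
  obtain ⟨c, hc⟩ := exists_C_of_associated h ((map_ne_zero_iff _ (P l).injective).2 hq)
  obtain ⟨b, hb⟩ := hP.shift_C (-l) c
  refine hP.shift_div_ne hper (k := k - l) (by omega) b ?_
  rw [← hb, ← hc, ← hP.shift_eq, ← hP.shift_eq, shift_map_div, ← shift_add, ← shift_add,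
    neg_add_cancel, shift_zero]
  congr 2
  ring

/-! ### The local rings at the shifts of an irreducible polynomial -/

/-- The rational functions without pole at the irreducible polynomial `q`. -/
def localRing (q : F[X]) (hq : Irreducible q) : Subring (RatFunc F) where
  carrier := {f | ∃ a b : F[X], ¬ q ∣ b ∧
    f = algebraMap F[X] (RatFunc F) a / algebraMap F[X] (RatFunc F) b}
  zero_mem' := ⟨0, 1, fun h => hq.not_isUnit (isUnit_of_dvd_one h), by simp⟩
  one_mem' := ⟨1, 1, fun h => hq.not_isUnit (isUnit_of_dvd_one h), by simp⟩
  add_mem' := by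
    rintro _ _ ⟨a, b, hb, rfl⟩ ⟨c, d, hd, rfl⟩
    refine ⟨a * d + b * c, b * d, fun h => (hq.prime.dvd_or_dvd h).elim hb hd, ?_⟩
    rw [div_add_div _ _ (algebraMap_polynomial_ne_zero (ne_zero_of_not_dvd hb))
      (algebraMap_polynomial_ne_zero (ne_zero_of_not_dvd hd))]
    simp
  mul_mem' := by
    rintro _ _ ⟨a, b, hb, rfl⟩ ⟨c, d, hd, rfl⟩
    refine ⟨a * c, b * d, fun h => (hq.prime.dvd_or_dvd h).elim hb hd, ?_⟩
    simp [div_mul_div_comm]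
  neg_mem' := by
    rintro _ ⟨a, b, hb, rfl⟩
    exact ⟨-a, b, hb, by simp [neg_div]⟩

/-- The rational functions without pole at `σ ^ k (q)`. -/
def shiftedLocalRing (σ : RatFunc F ≃+* RatFunc F) (q : F[X]) (hq : Irreducible q) (k : ℤ) :
    Subring (RatFunc F) :=
  (localRing q hq).comap (((show RingAut (RatFunc F) from σ) ^ (-k) : RingAut (RatFunc F)) :
    RatFunc F →+* RatFunc F)

theorem mem_shiftedLocalRing_iff {hq : Irreducible q} {k : ℤ} {f : RatFunc F} :
    f ∈ shiftedLocalRing σ q hq k ↔ shift σ (-k) f ∈ localRing q hq := Iff.rfl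

theorem shiftedLocalRing_zero {hq : Irreducible q} :
    shiftedLocalRing σ q hq 0 = localRing q hq := by
  ext f
  rw [mem_shiftedLocalRing_iff, neg_zero, shift_zero]

theorem map_mem_shiftedLocalRing {hq : Irreducible q} {k : ℤ} {f : RatFunc F}
    (hf : f ∈ shiftedLocalRing σ q hq k) : σ f ∈ shiftedLocalRing σ q hq (k + 1) := by
  rw [mem_shiftedLocalRing_iff] at hf ⊢
  rwa [← shift_one σ f, ← shift_add, show -(k + 1) + 1 = -k by ring]

theorem symm_map_mem_shiftedLocalRing {hq : Irreducible q} {k : ℤ} {f : RatFunc F}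
    (hf : f ∈ shiftedLocalRing σ q hq (k + 1)) : σ.symm f ∈ shiftedLocalRing σ q hq k := by
  rw [mem_shiftedLocalRing_iff] at hf ⊢
  rwa [← σ.apply_symm_apply f, ← shift_one σ (σ.symm f), ← shift_add,
    show -(k + 1) + 1 = -k by ring] at hf

theorem PolyShifts.div_mem_shiftedLocalRing (hP : PolyShifts σ P) {hq : Irreducible q} {k : ℤ}
    {a b : F[X]} (hb : ¬ P k q ∣ b) :
    algebraMap F[X] (RatFunc F) a / algebraMap F[X] (RatFunc F) b ∈
      shiftedLocalRing σ q hq k := by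
  rw [mem_shiftedLocalRing_iff, shift_map_div, hP.shift_eq, hP.shift_eq]
  exact ⟨_, _, fun h => hb (hP.neg_apply_dvd h), rfl⟩

theorem PolyShifts.not_dvd_of_polyXDegLE (hP : PolyShifts σ P) (hq : Irreducible q)
    (hper : period σ (algebraMap F[X] (RatFunc F) q) = 0) {d : ℕ} (hd : d < q.natDegree) {b : F[X]}
    (hb : PolyXDegLE σ d b) (k : ℤ) : ¬ P k q ∣ b := by
  intro h
  have := hb _ ((MulEquiv.irreducible_iff (P k)).2 hq) h (hP.period_eq_zero hper k)
  rw [hP.natDegree_eq] at this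
  omega

/-- The denominator has finitely many irreducible factors, and distinct shifts of `q` are not
associated. -/
theorem PolyShifts.eventually_mem_shiftedLocalRing (hP : PolyShifts σ P) (hq : Irreducible q)
    (hper : period σ (algebraMap F[X] (RatFunc F) q) = 0) (f : RatFunc F) :
    ∀ᶠ k in Filter.cofinite, f ∈ shiftedLocalRing σ q hq k := by
  classical
  have hfin : {k : ℤ | P k q ∣ f.denom}.Finite := by
    have h1 : ∀ k ∈ {k : ℤ | P k q ∣ f.denom},
        ∃ p ∈ UniqueFactorizationMonoid.normalizedFactors f.denom, Associated (P k q) p :=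
      fun k hk => UniqueFactorizationMonoid.exists_mem_normalizedFactors_of_dvd f.denom_ne_zero
        ((MulEquiv.irreducible_iff (P k)).2 hq) hk
    choose! p hp hp' using h1
    refine Set.Finite.of_injOn (f := p)
      (t := ((UniqueFactorizationMonoid.normalizedFactors f.denom).toFinset : Set F[X]))
      (fun k hk => Finset.mem_coe.2 (Multiset.mem_toFinset.2 (hp k hk))) ?_ (Finset.finite_toSet _)
    intro k hk l hl hkl
    refine hP.eq_of_associated hq.ne_zero hper ((hp' k hk).trans ?_)
    rw [hkl]
    exact (hp' l hl).symm
  refine hfin.subset fun k hk => ?_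
  by_contra h
  refine hk ?_
  change f ∈ shiftedLocalRing σ q hq k
  rw [← f.num_div_denom]
  exact hP.div_mem_shiftedLocalRing h

/-- The subring `O` contains the fractions whose denominator has `x`-degree `≤ d`. -/
def ContainsXDegLE (σ : RatFunc F ≃+* RatFunc F) (d : ℕ) (O : Subring (RatFunc F)) : Prop :=
  ∀ a b : F[X], PolyXDegLE σ d b →
    algebraMap F[X] (RatFunc F) a / algebraMap F[X] (RatFunc F) b ∈ O

/-- The full field serves for the linear shape of the solutions, the shifted local rings for their
poles. -/
theorem containsXDegLE_top (d : ℕ) : ContainsXDegLE σ d ⊤ := fun _ _ _ => Subring.mem_top _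

theorem PolyShifts.containsXDegLE (hP : PolyShifts σ P) (hq : Irreducible q)
    (hper : period σ (algebraMap F[X] (RatFunc F) q) = 0) {d : ℕ} (hd : d < q.natDegree) (k : ℤ) :
    ContainsXDegLE σ d (shiftedLocalRing σ q hq k) :=
  fun _ _ hb => hP.div_mem_shiftedLocalRing (hP.not_dvd_of_polyXDegLE hq hper hd hb k)

theorem polyXDegLE_one (σ : RatFunc F ≃+* RatFunc F) (d : ℕ) : PolyXDegLE σ d 1 :=
  fun _ hh h1 => absurd (isUnit_of_dvd_one h1) hh.not_isUnit

section ContainsXDegLE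

variable {d : ℕ} {O : Subring (RatFunc F)}

theorem ContainsXDegLE.algebraMap_mem (hO : ContainsXDegLE σ d O) (f : F[X]) :
    algebraMap F[X] (RatFunc F) f ∈ O := by
  simpa using hO f 1 (polyXDegLE_one σ d)

theorem ContainsXDegLE.mem (hO : ContainsXDegLE σ d O) {f : RatFunc F}
    (hf : PolyXDegLE σ d f.denom) : f ∈ O := by
  rw [← f.num_div_denom]
  exact hO _ _ hf

theorem ContainsXDegLE.unitIn (hO : ContainsXDegLE σ d O) {f : RatFunc F} (h0 : f ≠ 0)
    (hf : RatXDegLE σ d f) : UnitIn O f := by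
  refine ⟨hO.mem hf.2, f⁻¹, ?_, mul_inv_cancel₀ h0⟩
  rw [← f.num_div_denom, inv_div]
  exact hO _ _ hf.1

/-- A root of unity is integral over `F[x]`, hence a polynomial, and its inverse is one of its
powers. -/
theorem ContainsXDegLE.unitIn_of_pow_eq_one (hO : ContainsXDegLE σ d O) {f : RatFunc F} {n : ℕ}
    (hn : 0 < n) (hf : f ^ n = 1) : UnitIn O f := by
  have hint : IsIntegral F[X] f :=
    IsIntegral.of_pow hn (by rw [hf]; exact isIntegral_one)
  obtain ⟨p, rfl⟩ := IsIntegrallyClosed.isIntegral_iff.1 hint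
  have := hO.algebraMap_mem p
  exact ⟨this, algebraMap F[X] (RatFunc F) p ^ (n - 1), O.pow_mem this _,
    by rw [← pow_succ', Nat.sub_add_cancel hn, hf]⟩

end ContainsXDegLE

/-! ### Proper fractions -/

/-- The fractions `a / q ^ m` with `deg a < m deg q`. -/
def properFractions (q : F[X]) (hq : q ≠ 0) : AddSubgroup (RatFunc F) where
  carrier := {f | ∃ (a : F[X]) (m : ℕ), a.degree < ((m * q.natDegree : ℕ) : WithBot ℕ) ∧
    f = algebraMap F[X] (RatFunc F) a / algebraMap F[X] (RatFunc F) q ^ m}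
  zero_mem' := ⟨0, 0, by rw [degree_zero]; exact WithBot.bot_lt_coe _, by simp⟩
  add_mem' := by
    have key : ∀ (a : F[X]) (m l : ℕ), a.degree < ((m * q.natDegree : ℕ) : WithBot ℕ) →
        (a * q ^ l).degree < (((m + l) * q.natDegree : ℕ) : WithBot ℕ) := by
      intro a m l ha
      by_cases h0 : a = 0
      · rw [h0, zero_mul, degree_zero]
        exact WithBot.bot_lt_coe _
      · rw [degree_eq_natDegree (mul_ne_zero h0 (pow_ne_zero l hq)),
          natDegree_mul h0 (pow_ne_zero l hq), natDegree_pow, Nat.cast_lt]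
        rw [degree_eq_natDegree h0, Nat.cast_lt] at ha
        rw [add_mul]
        omega
    rintro _ _ ⟨a, m, ha, rfl⟩ ⟨b, l, hb, rfl⟩
    refine ⟨a * q ^ l + b * q ^ m, m + l, ?_, ?_⟩
    · refine (degree_add_le _ _).trans_lt (max_lt (key a m l ha) ?_)
      rw [add_comm m l]
      exact key b l m hb
    · have h := algebraMap_polynomial_ne_zero hq
      rw [div_add_div _ _ (pow_ne_zero m h) (pow_ne_zero l h), ← pow_add]
      simp [mul_comm]
  neg_mem' := by
    rintro _ ⟨a, m, ha, rfl⟩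
    exact ⟨-a, m, by rwa [degree_neg], by simp [neg_div]⟩

theorem C_mul_mem_properFractions {hq : q ≠ 0} {f : RatFunc F} (c : F)
    (hf : f ∈ properFractions q hq) : RatFunc.C c * f ∈ properFractions q hq := by
  obtain ⟨a, m, ha, rfl⟩ := hf
  refine ⟨C c * a, m, ?_, ?_⟩
  · refine lt_of_le_of_lt ?_ ha
    rw [← smul_eq_C_mul]
    exact degree_smul_le c a
  · rw [map_mul, RatFunc.algebraMap_C, mul_div_assoc]

/-- Without pole at `q`, the numerator is divisible by `q ^ m`, and its degree is too small for that
unless it is zero. -/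
theorem eq_zero_of_mem_properFractions (hq : Irreducible q) {f : RatFunc F}
    (h₁ : f ∈ properFractions q hq.ne_zero) (h₂ : f ∈ localRing q hq) : f = 0 := by
  obtain ⟨a, m, ha, rfl⟩ := h₁
  obtain ⟨b, c, hc, h⟩ := h₂
  rw [div_eq_div_iff (pow_ne_zero m (algebraMap_polynomial_ne_zero hq.ne_zero))
    (algebraMap_polynomial_ne_zero (ne_zero_of_not_dvd hc)), ← map_pow, ← map_mul, ← map_mul] at h
  have h := algebraMap_polynomial_injective h
  have hdvd : q ^ m ∣ a := by
    refine hq.prime.pow_dvd_of_dvd_mul_right m hc ?_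
    rw [h]
    exact dvd_mul_left _ _
  have : a = 0 := by
    refine eq_zero_of_dvd_of_degree_lt hdvd ?_
    rwa [degree_pow, degree_eq_natDegree hq.ne_zero, nsmul_eq_mul, ← Nat.cast_mul]
  rw [this, map_zero, zero_div]

end RationalFunctions

/-! ### Towers of bounded `x`-degree preserve coefficient rings -/

section StableLevels

variable {F : Type u} [Field F] {σ : RatFunc F ≃+* RatFunc F} {d : ℕ}
  {E : Type v} [CommRing E] {σE : E ≃+* E} {φ : RatFunc F →+* E}
  {e : ℕ} {kind : Fin e → Kind} {t : Fin e → E}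

/-- The level is taken from the first representation and the coefficient ring from the second. -/
theorem mem_levelOver_inter {A : Type*} [CommRing A] {φ : A →+* E} (ht : Admissible kind t)
    (hind : Indep φ ⊤ (IsReducedExp kind) (tpow t)) {O O' : Subring A} {i i' : ℕ} {f : E}
    (h : f ∈ levelOver φ O kind t i) (h' : f ∈ levelOver φ O' kind t i') :
    f ∈ levelOver φ O' kind t i := by
  rw [mem_levelOver_iff ht] at h h' ⊢
  obtain ⟨c, hc, hc', hf⟩ := mem_normalForms_inter hind h h'
  exact ⟨c, fun n => (hc n).2, hc', hf⟩

theorem shiftStable_of_hasXDegLE (hE : IsRPSExtension σ σE φ kind t)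
    (hdeg : HasXDegLE σ σE φ d kind t) {O : Subring (RatFunc F)} (hO : ContainsXDegLE σ d O) :
    ShiftStable σE φ O kind t where
  unit i hi := by
    have hφ : ∀ a, UnitIn O a → UnitIn (levelOver φ O kind t i) (φ a) := fun a ha =>
      ha.map φ fun x hx => map_mem_levelOver hx _
    cases hk : kind i with
    | rootOfUnity ν =>
      obtain ⟨a, m, ⟨n, hn, han⟩, hm, hσ⟩ := hdeg.simple.root i ν hk
      refine ⟨_, (hφ a (hO.unitIn_of_pow_eq_one hn han)).mul (UnitIn.tpow fun j hj => ?_), hσ⟩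
      obtain ⟨hji, ν', hν'⟩ := hm j hj
      exact unitIn_gen hE.admissible hji (by simp [hν'])
    | prod =>
      obtain ⟨a, m, ha, ha', hm, hσ⟩ := hdeg.prod i hk
      refine ⟨_, (hφ a (hO.unitIn ha ha')).mul (UnitIn.tpow fun j hj => ?_), hσ⟩
      exact unitIn_gen hE.admissible (hm j hj).1 (hm j hj).2
    | sum => exact absurd hk hi
  sum i hi := by
    obtain ⟨b, ⟨c, ⟨hc, hsum⟩, hb, hlcm⟩, hbd⟩ := hdeg.sum i hi
    -- The bound on the denominators restricts the coefficients, not the monomials that occur. The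
    -- latter are restricted by the tower, in `h2`.
    have h1 : σE (t i) - t i ∈ levelOver φ O kind t e := by
      rw [hsum]
      refine Subring.sum_mem _ fun n hn => Subring.mul_mem _ (map_mem_levelOver ?_ _)
        (tpow_mem_levelOver hE.admissible (hc n hn) fun j hj => absurd j.2 (not_lt.2 hj))
      refine hO.mem fun h hh hhd => hbd h hh ?_
      exact hhd.trans ((hlcm b).1 dvd_rfl n hn)
    have h2 : σE (t i) - t i ∈ level φ kind t i := by
      have := hE.monomial i
      rw [hi] at this
      exact this.2
    rw [level_eq_levelOver] at h2
    exact mem_levelOver_inter hE.admissible hE.indep h2 h1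

theorem isReducedExp_append_left {k : ℕ} {kindH : Fin k → Kind} {n : Fin (e + k) → ℤ}
    (hn : IsReducedExp (Fin.append kind kindH) n) :
    IsReducedExp kind fun j => n (Fin.castAdd k j) := by
  rw [isReducedExp_iff] at hn ⊢
  intro j
  simpa using hn (Fin.castAdd k j)

theorem isReducedExp_append_right {k : ℕ} {kindH : Fin k → Kind} {n : Fin (e + k) → ℤ}
    (hn : IsReducedExp (Fin.append kind kindH) n) :
    IsReducedExp kindH fun j => n (Fin.natAdd e j) := by
  rw [isReducedExp_iff] at hn ⊢
  intro j
  simpa using hn (Fin.natAdd e j)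

/-- The conditions on the `τ` are stated in the joint tower of the `t` and the `τ`. In each power
product, the part in the `t` becomes a coefficient from `O'`. -/
theorem shiftStable_of_isXDegExtension {S : Type w} [CommRing S] {σS : S ≃+* S} {ψ : E →+* S}
    {H : Type*} [CommRing H] {σH : H ≃+* H} {ι : S →+* H} {k : ℕ} {kindH : Fin k → Kind}
    {τ : Fin k → H} (ht : Admissible kind t)
    (hH : IsXDegExtension σ φ d kind t σS ψ σH ι kindH τ)
    {O : Subring (RatFunc F)} (hO : ContainsXDegLE σ d O) {O' : Subring S}
    (hO' : ∀ f ∈ levelOver φ O kind t e, ψ f ∈ O') :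
    ShiftStable σH ι O' kindH τ := by
  have hτ := hH.ext.admissible
  have hunit : ∀ (i : ℕ) (f : E), UnitIn (levelOver φ O kind t e) f →
      UnitIn (levelOver ι O' kindH τ i) (ι (ψ f)) := fun i f hf =>
    hf.map (ι.comp ψ) fun x hx => map_mem_levelOver (hO' x hx) _
  have hφ : ∀ (i : ℕ) (a : RatFunc F), UnitIn O a →
      UnitIn (levelOver ι O' kindH τ i) (((ι.comp ψ).comp φ) a) := fun i a ha =>
    hunit i (φ a) (ha.map φ fun x hx => map_mem_levelOver hx _)
  have hgen : ∀ (i : Fin k) (j : Fin (e + k)), j < Fin.natAdd e i →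
      Fin.append kind kindH j ≠ Kind.sum →
      UnitIn (levelOver ι O' kindH τ i) (Fin.append (fun j => ι (ψ (t j))) τ j) := by
    intro i j
    refine Fin.addCases (fun j _ hj => ?_) (fun j hji hj => ?_) j
    · rw [Fin.append_left] at hj ⊢
      exact hunit i _ (unitIn_gen ht j.2 hj)
    · rw [Fin.append_right] at hj ⊢
      exact unitIn_gen hτ (Nat.lt_of_add_lt_add_left hji) hj
  constructor
  · intro i hi
    cases hk : kindH i with
    | rootOfUnity ν =>
      obtain ⟨a, m, ⟨n, hn, han⟩, hm, hσ⟩ := hH.deg.simple.root (Fin.natAdd e i) ν (by simp [hk])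
      rw [Fin.append_right] at hσ
      refine ⟨_, (hφ i a (hO.unitIn_of_pow_eq_one hn han)).mul (UnitIn.tpow fun j hj => ?_), hσ⟩
      obtain ⟨hji, ν', hν'⟩ := hm j hj
      exact hgen i j hji (by simp [hν'])
    | prod =>
      obtain ⟨a, m, ha, ha', hm, hσ⟩ := hH.deg.prod (Fin.natAdd e i) (by simp [hk])
      rw [Fin.append_right] at hσ
      refine ⟨_, (hφ i a (hO.unitIn ha ha')).mul (UnitIn.tpow fun j hj => ?_), hσ⟩
      exact hgen i j (hm j hj).1 (hm j hj).2
    | sum => exact absurd hk hi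
  · intro i hi
    obtain ⟨b, ⟨c, ⟨hc, hsum⟩, hb, hlcm⟩, hbd⟩ := hH.deg.sum (Fin.natAdd e i) (by simp [hi])
    rw [Fin.append_right] at hsum
    have h1 : σH (τ i) - τ i ∈ levelOver ι O' kindH τ k := by
      rw [hsum]
      refine Subring.sum_mem _ fun n hn => ?_
      have hcn : c n ∈ O := hO.mem fun h hh hhd => hbd h hh
        (hhd.trans ((hlcm b).1 dvd_rfl n hn))
      have hred := isReducedExp_append_left (hc n hn)
      beta_reduce
      rw [tpow_append]
      change _ * (tpow (fun j => (ι.comp ψ) (t j)) _ * _) ∈ _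
      rw [← map_tpow (ι.comp ψ) t _ (hred.nonneg_or_isUnit ht)]
      refine Subring.mul_mem _ (map_mem_levelOver (hO' _ (map_mem_levelOver hcn _)) _)
        (Subring.mul_mem _ (map_mem_levelOver (hO' _ (tpow_mem_levelOver ht hred ?_)) _)
          (tpow_mem_levelOver hτ (isReducedExp_append_right (hc n hn)) ?_))
      · exact fun j hj => absurd j.2 (not_lt.2 hj)
      · exact fun j hj => absurd j.2 (not_lt.2 hj)
    have h2 : σH (τ i) - τ i ∈ level ι kindH τ i := by
      have := hH.ext.monomial i
      rw [hi] at this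
      exact this.2
    rw [level_eq_levelOver] at h2
    exact mem_levelOver_inter hτ hH.ext.indep h2 h1

end StableLevels

/-- For `k ≠ 0` the hypotheses make `P (k - 1)` and `P k` equivalent. `P` holds far out on both
sides; it propagates downwards to `P 0` and upwards to `P (-1)`, which gives `Q 0`. -/
theorem zero_of_shift_iff {P Q : ℤ → Prop} (hev : ∀ᶠ k in Filter.cofinite, P k)
    (hshift : ∀ k, P k ↔ Q (k + 1)) (hne : ∀ k, k ≠ 0 → (P k ↔ Q k)) : P 0 ∧ Q 0 := by
  have hfin : {k | ¬ P k}.Finite := hev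
  obtain ⟨a, ha⟩ := hfin.bddAbove
  obtain ⟨b, hb⟩ := hfin.bddBelow
  have hgt : ∀ k, a < k → P k := fun k hk => by
    by_contra h
    exact absurd (ha h) (not_le.2 hk)
  have hlt : ∀ k, k < b → P k := fun k hk => by
    by_contra h
    exact absurd (hb h) (not_le.2 hk)
  constructor
  · have : ∀ k ≤ max (a + 1) 0, 0 ≤ k → P k := by
      refine Int.leInductionDown (fun _ => hgt _ (by omega)) fun k _ ih h0 => ?_
      have := (hne k (by omega)).1 (ih (by omega))
      rwa [hshift, sub_add_cancel]
    exact this 0 (le_max_right _ _) le_rfl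
  · have : ∀ k, min (b - 1) (-1) ≤ k → k < 0 → P k :=
      Int.leInduction (fun _ => hlt _ (by omega)) fun k _ ih h0 =>
        (hne _ (by omega)).2 ((hshift k).1 (ih (by omega)))
    simpa using (hshift (-1)).1 (this (-1) (min_le_right _ _) (by omega))

theorem exists_of_mem_levelOver_zero {A E : Type*} [CommRing A] [CommRing E] {φ : A →+* E}
    {O : Subring A} {e : ℕ} {kind : Fin e → Kind} {t : Fin e → E} {f : E}
    (hf : f ∈ levelOver φ O kind t 0) : ∃ a ∈ O, φ a = f :=
  Subring.mem_map.1 (levelOver_le (L := O.map φ)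
    (fun a ha => Subring.mem_map.2 ⟨a, ha, rfl⟩) (fun _ hj => absurd hj (Nat.not_lt_zero _))
    (fun _ hj => absurd hj (Nat.not_lt_zero _)) hf)

/-! ### The pole argument along an orbit -/

section Poles

variable {F : Type u} [Field F] {σF : F ≃+* F} {σ : RatFunc F ≃+* RatFunc F} {d : ℕ}
  {E : Type v} [CommRing E] {σE : E ≃+* E} {φ : RatFunc F →+* E}
  {e : ℕ} {kind : Fin e → Kind} {t : Fin e → E}
  {S : Type w} [CommRing S] {σS : S ≃+* S} {ψ : E →+* S}
  {H : Type*} [CommRing H] {σH : H ≃+* H} {ι : S →+* H} {k : ℕ} {kindH : Fin k → Kind}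
  {τ : Fin k → H} {q : F[X]}

/-- If `σ(G) - G` has poles at most at `q` among the shifts of `q`, then it has no such poles. -/
theorem mem_localRing_of_shift_sub (hF : IsPiSigmaFieldExt σF σ)
    (hE : IsRPSExtension σ σE φ kind t) (hdeg : HasXDegLE σ σE φ d kind t)
    (hψ : Function.Injective ψ) (hσS : ∀ a, σS (ψ a) = ψ (σE a))
    (hH : IsXDegExtension σ φ d kind t σS ψ σH ι kindH τ) (hq : Irreducible q)
    (hper : period σ (algebraMap F[X] (RatFunc F) q) = 0) (hd : d < q.natDegree)
    {G : H} (hG : G ∈ level (ι.comp ψ) kindH τ k) {f : E} (hGf : σH G - G = ι (ψ f))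
    (hf : ∀ k : ℤ, k ≠ 0 → f ∈ levelOver φ (shiftedLocalRing σ q hq k) kind t e) :
    f ∈ levelOver φ (localRing q hq) kind t e := by
  obtain ⟨P, hP⟩ := hF.exists_polyShifts
  have ht := hE.admissible
  have hτ := hH.ext.admissible
  -- `L m` and `M m` collect the elements without pole at `σ ^ m (q)`, in `E` and in the part of `H`
  -- free of the contributions.
  set L : ℤ → Subring E := fun k => levelOver φ (shiftedLocalRing σ q hq k) kind t e with hL
  set M : ℤ → Subring H := fun m => levelOver ι ((L m).map ψ) kindH τ k with hM
  have hO := hP.containsXDegLE hq hper hd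
  have hstab : ∀ m, ShiftStable σH ι ((L m).map ψ) kindH τ := fun m =>
    shiftStable_of_isXDegExtension ht hH (hO m) fun f hf => Subring.mem_map.2 ⟨f, hf, rfl⟩
  have hLshift : ∀ m, ∀ a ∈ L m, σE a ∈ L (m + 1) := fun m a ha =>
    (shiftStable_of_hasXDegLE hE hdeg (hO (m + 1))).map_mem ht hE.extends_base
      (fun a ha => map_mem_shiftedLocalRing ha) ha
  have hLshift' : ∀ m, ∀ a ∈ L (m + 1), σE.symm a ∈ L m := fun m a ha =>
    (shiftStable_of_hasXDegLE hE hdeg (hO (m + 1))).symm_map_mem ht hE.extends_base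
      (fun a ha => symm_map_mem_shiftedLocalRing ha) ha
  have hMshift : ∀ m, G ∈ M m ↔ σH G ∈ M (m + 1) := by
    intro m
    constructor
    · refine fun h => (hstab (m + 1)).map_mem hτ hH.ext.extends_base ?_ h
      rintro _ ⟨a, ha, rfl⟩
      exact Subring.mem_map.2 ⟨σE a, hLshift m a ha, (hσS a).symm⟩
    · intro h
      have := (hstab (m + 1)).symm_map_mem hτ hH.ext.extends_base (O := (L m).map ψ) ?_ h
      · rwa [RingEquiv.symm_apply_apply] at this
      · rintro _ ⟨a, ha, rfl⟩
        refine Subring.mem_map.2 ⟨σE.symm a, hLshift' m a ha, ?_⟩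
        rw [RingEquiv.eq_symm_apply, hσS, RingEquiv.apply_symm_apply]
  have hev : ∀ᶠ m in Filter.cofinite, G ∈ M m := by
    rw [level_comp_eq_levelOver] at hG
    refine eventually_mem_levelOver (C := fun m => (L m).map ψ) ?_ hG
    rintro _ ⟨a, rfl⟩
    have : a ∈ levelOver φ ⊤ kind t e := by
      rw [← level_eq_levelOver, hE.generate]
      exact Subring.mem_top a
    refine (eventually_mem_levelOver
      (fun u _ => hP.eventually_mem_shiftedLocalRing hq hper u) this).mono fun m hm => ?_
    exact Subring.mem_map.2 ⟨a, hm, rfl⟩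
  have hfM : ∀ m, f ∈ L m → ι (ψ f) ∈ M m := fun m hm =>
    map_mem_levelOver (Subring.mem_map.2 ⟨f, hm, rfl⟩) k
  obtain ⟨h1, h2⟩ := zero_of_shift_iff (Q := fun m => σH G ∈ M m) hev hMshift (fun m hm => by
    have h1 := hfM m (hf m hm)
    rw [← hGf] at h1
    constructor
    · intro h
      simpa using (M m).add_mem h1 h
    · intro h
      simpa using (M m).sub_mem h h1)
  have h3 : ι (ψ f) ∈ M 0 := by
    rw [← hGf]
    exact (M 0).sub_mem h2 h1
  -- As an element of level 0, `ι (ψ f)` is a single coefficient, and membership in `M 0` puts this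
  -- coefficient into the image of `L 0`.
  have h4 : ι (ψ f) ∈ levelOver ι ⊤ kindH τ 0 := map_mem_levelOver (Subring.mem_top _) 0
  have h5 := mem_levelOver_inter hτ hH.ext.indep h4 h3
  obtain ⟨_, ⟨a, ha, rfl⟩, haf⟩ := exists_of_mem_levelOver_zero h5
  have h6 := hψ (hH.ext.injective haf)
  rw [← h6]
  rw [← shiftedLocalRing_zero (σ := σ)]
  exact ha

theorem frac_eq {p : E} {q : F[X]} {n : ℕ} :
    frac φ p q n = φ ((algebraMap F[X] (RatFunc F) q ^ n)⁻¹) * p := rfl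

theorem frac_mem_normalForms (hq : q ≠ 0) {p : E} {n : ℕ}
    (hp : IsPolyEltDegLT φ kind t p (n * q.natDegree)) :
    frac φ p q n ∈ normalForms φ (properFractions q hq) kind t e := by
  obtain ⟨c, ⟨hc, rfl⟩, hdeg⟩ := hp
  rw [frac_eq, Finsupp.mul_sum]
  refine AddSubgroup.sum_mem _ fun m hm => ?_
  beta_reduce
  rw [RingHom.comp_apply, ← mul_assoc, ← map_mul]
  refine term_mem_normalForms ⟨c m, n, hdeg m, ?_⟩ (hc m hm)
    fun j hj => absurd j.2 (not_lt.2 hj)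
  rw [div_eq_inv_mul]

theorem frac_mem_levelOver (ht : Admissible kind t) {p : E} (hp : IsPolyElt φ kind t p)
    (hq : PolyXDegLE σ d q) {O : Subring (RatFunc F)} (hO : ContainsXDegLE σ d O) :
    frac φ p q 1 ∈ levelOver φ O kind t e := by
  obtain ⟨c, hc, rfl⟩ := hp
  rw [frac_eq, Finsupp.mul_sum]
  refine Subring.sum_mem _ fun m hm => ?_
  beta_reduce
  rw [RingHom.comp_apply, ← mul_assoc, ← map_mul]
  refine Subring.mul_mem _ (map_mem_levelOver ?_ e)
    (tpow_mem_levelOver ht (hc m hm) fun j hj => absurd j.2 (not_lt.2 hj))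
  rw [pow_one, ← div_eq_inv_mul]
  exact hO _ _ hq

theorem normalForms_mono {O O' : AddSubgroup (RatFunc F)} (h : O ≤ O') {i : ℕ} :
    normalForms φ O kind t i ≤ normalForms φ O' kind t i := by
  rintro _ ⟨c, hc, hc', rfl⟩
  exact ⟨c, fun n => h (hc n), hc', rfl⟩

theorem C_mul_mem_normalForms {hq : q ≠ 0} (a : F) {f : E}
    (hf : f ∈ normalForms φ (properFractions q hq) kind t e) :
    φ (RatFunc.C a) * f ∈ normalForms φ (properFractions q hq) kind t e := by
  obtain ⟨c, hc, hc', rfl⟩ := hf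
  rw [Finsupp.mul_sum]
  refine AddSubgroup.sum_mem _ fun m hm => ?_
  beta_reduce
  rw [← mul_assoc, ← map_mul]
  exact term_mem_normalForms (C_mul_mem_properFractions a (hc m)) (hc' m hm).1 (hc' m hm).2

theorem properFractions_le_shiftedLocalRing {P : ℤ → F[X] ≃+* F[X]} (hP : PolyShifts σ P)
    (hq : Irreducible q) {k : ℤ} {r : F[X]} {hr : r ≠ 0} (h : ¬ P k q ∣ r) :
    properFractions r hr ≤ (shiftedLocalRing σ q hq k).toAddSubgroup := by
  rintro _ ⟨a, m, _, rfl⟩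
  rw [← map_pow]
  exact hP.div_mem_shiftedLocalRing fun hdvd =>
    h (((MulEquiv.irreducible_iff (P k)).2 hq).prime.dvd_of_dvd_pow hdvd)

/-- Irreducible polynomials dividing each other are associated. This contradicts period 0 if `q =
r`, and inequivalence otherwise. -/
theorem IsDXSet.not_dvd {Q : Finset F[X]} (hQ : IsDXSet σ d Q) {P : ℤ → F[X] ≃+* F[X]}
    (hP : PolyShifts σ P) {q r : F[X]} (hq : q ∈ Q) (hr : r ∈ Q) {k : ℤ} (h : q ≠ r ∨ k ≠ 0) :
    ¬ P k q ∣ r := by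
  intro hdvd
  have hq' := hQ.irreducible q hq
  have hr' := hQ.irreducible r hr
  have hassoc := ((MulEquiv.irreducible_iff (P k)).2 hq').associated_of_dvd hr' hdvd
  by_cases hqr : q = r
  · subst hqr
    refine (h.resolve_left (not_not.2 rfl)) (hP.eq_of_associated hq'.ne_zero
      (hQ.period_zero q hq) (l := 0) ?_)
    rwa [hP.zero_apply]
  · obtain ⟨c, hc⟩ := exists_C_of_associated hassoc hr'.ne_zero
    refine hQ.coprime q hq r hr hqr ⟨k, c, ?_⟩
    rw [hP.shift_eq, hc]

/-- Uniqueness of the `σ`-reduced form. -/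
theorem eq_zero_of_shift_sub_eq (hF : IsPiSigmaFieldExt σF σ)
    (hE : IsRPSExtension σ σE φ kind t) (hdeg : HasXDegLE σ σE φ d kind t)
    (hψ : Function.Injective ψ) (hσS : ∀ a, σS (ψ a) = ψ (σE a))
    (hH : IsXDegExtension σ φ d kind t σS ψ σH ι kindH τ) {Q : Finset F[X]} (hQ : IsDXSet σ d Q)
    {Y : F[X] → E} (hY : ∀ (q : F[X]) (hq : q ∈ Q),
      Y q ∈ normalForms φ (properFractions q (hQ.irreducible q hq).ne_zero) kind t e)
    {ρ : E} (hρ : ∀ O, ContainsXDegLE σ d O → ρ ∈ levelOver φ O kind t e)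
    {G : H} (hG : G ∈ level (ι.comp ψ) kindH τ k)
    (hGY : σH G - G = ι (ψ (∑ q ∈ Q, Y q + ρ))) : ∀ q ∈ Q, Y q = 0 := by
  classical
  intro q hq
  obtain ⟨P, hP⟩ := hF.exists_polyShifts
  have ht := hE.admissible
  have hirr := hQ.irreducible q hq
  have hO := hP.containsXDegLE hirr (hQ.period_zero q hq) (hQ.degree q hq)
  have hmem : ∀ (k : ℤ) (r : F[X]) (_ : r ∈ Q), (q ≠ r ∨ k ≠ 0) →
      Y r ∈ levelOver φ (shiftedLocalRing σ q hirr k) kind t e := by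
    intro k r hr h
    rw [mem_levelOver_iff ht]
    exact normalForms_mono (properFractions_le_shiftedLocalRing hP hirr (hQ.not_dvd hP hq hr h))
      (hY r hr)
  have h0 := mem_localRing_of_shift_sub hF hE hdeg hψ hσS hH hirr (hQ.period_zero q hq)
    (hQ.degree q hq) hG hGY fun k hk => Subring.add_mem _
      (Subring.sum_mem _ fun r hr => hmem k r hr (Or.inr hk)) (hρ _ (hO k))
  rw [← Finset.add_sum_erase _ _ hq, add_assoc, ← shiftedLocalRing_zero (σ := σ)] at h0
  -- Only `Y q` could have a pole at `q`; subtracting the other summands shows that it has none.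
  have h1 := Subring.sub_mem _ h0 (Subring.add_mem _ (Subring.sum_mem _ fun r hr =>
    hmem 0 r (Finset.mem_of_mem_erase hr) (Or.inl (Finset.ne_of_mem_erase hr).symm)) (hρ _ (hO 0)))
  rw [add_sub_cancel_right, mem_levelOver_iff ht, shiftedLocalRing_zero] at h1
  obtain ⟨c, hc, -, hsum⟩ := mem_normalForms_inter hE.indep (hY q hq) h1
  rw [hsum]
  refine Finset.sum_eq_zero fun n _ => ?_
  beta_reduce
  rw [eq_zero_of_mem_properFractions hirr (hc n).1 (hc n).2, map_zero, zero_mul]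

end Poles

/-! ### Shape of the solutions -/

section Decomposition

variable {F : Type u} [Field F] {σF : F ≃+* F} {σ : RatFunc F ≃+* RatFunc F} {d : ℕ}
  {E : Type v} [CommRing E] {σE : E ≃+* E} {φ : RatFunc F →+* E}
  {e : ℕ} {kind : Fin e → Kind} {t : Fin e → E} {Q : Finset F[X]}
  {S : Type w} [CommRing S] {σS : S ≃+* S} {ψ : E →+* S}
  {r : ℕ} {s : Fin r → S} {D : QData F E r}
  {H : Type*} [CommRing H] {σH : H ≃+* H} {ι : S →+* H} {k : ℕ} {kindH : Fin k → Kind}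
  {τ : Fin k → H}

theorem IsRPSExtension.map_of_const {A E : Type*} [CommRing A] [CommRing E] {σA : A ≃+* A}
    {σE : E ≃+* E} {φ : A →+* E} {e : ℕ} {kind : Fin e → Kind} {t : Fin e → E}
    (h : IsRPSExtension σA σE φ kind t) {c : E} (hc : σE c = c) : ∃ a, σA a = a ∧ φ a = c := by
  obtain ⟨a, rfl⟩ := h.const c hc
  exact ⟨a, h.injective (by rw [← h.extends_base, hc]), rfl⟩

theorem IsQReduced.exists_of_const (hF : IsPiSigmaFieldExt σF σ)
    (hS : IsQReduced σ σE φ d kind t Q σS ψ s D) {c : S} (hc : σS c = c) :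
    ∃ a : constants σF, ψ (φ (RatFunc.C (a : F))) = c := by
  obtain ⟨b, hb, rfl⟩ := hS.sum_ext.map_of_const hc
  obtain ⟨u, hu, rfl⟩ := hS.base_ext.map_of_const hb
  obtain ⟨a, rfl⟩ := hF.const u hu
  rw [hF.extends_base] at hu
  exact ⟨⟨a, RatFunc.C_injective hu⟩, rfl⟩

theorem map_const (hF : IsPiSigmaFieldExt σF σ) (hE : IsRPSExtension σ σE φ kind t)
    (a : constants σF) : σE (φ (RatFunc.C (a : F))) = φ (RatFunc.C (a : F)) := by
  rw [hE.extends_base, hF.extends_base, show σF a = a from a.2]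

theorem eq_zero_of_natCast_mul_eq_zero [CharZero F] {R : Type*} [CommRing R] (g : F →+* R)
    (m : ℕ) (hm : m ≠ 0) (x : R) (hx : m * x = 0) : x = 0 := by
  have h1 : g ((m : F)⁻¹) * (m : R) = 1 := by
    rw [← map_natCast g, ← map_mul, inv_mul_cancel₀ (Nat.cast_ne_zero.2 hm), map_one]
  rw [← one_mul x, ← h1, mul_assoc, hx, mul_zero]

open Classical in
/-- The shape of the solutions of the telescoping equation for an element in `σ`-reduced form. -/
theorem exists_decomposition [CharZero F] (hF : IsPiSigmaFieldExt σF σ)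
    (hS : IsQReduced σ σE φ d kind t Q σS ψ s D)
    (hH : IsXDegExtension σ φ d kind t σS ψ σH ι kindH τ)
    {Qt : Finset F[X]} (hQt : IsDXSet σ d Qt) (hQ : Q ⊆ Qt) {g ρ : E} {p : F[X] → E}
    {n : F[X] → ℕ} (hp : ∀ q ∈ Qt, IsPolyEltDegLT φ kind t (p q) (n q * q.natDegree))
    (hρ : ∀ O, ContainsXDegLE σ d O → ρ ∈ levelOver φ O kind t e) {h : H}
    (hh : σH h - h = ι (ψ (σE g - g + ((∑ q ∈ Qt, frac φ (p q) q (n q)) + ρ)))) :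
    ∃ (c : Fin r → constants σF) (e' : H), e' ∈ level (ι.comp ψ) kindH τ k ∧
      (h ∈ level (ι.comp ψ) kindH τ k → c = 0) ∧
      h = ∑ j, ι (ψ (φ (RatFunc.C (c j : F))) * s j) + e' ∧
      ∀ q ∈ Qt, frac φ (p q) q (n q) = ∑ j : D.Idx q,
        φ (RatFunc.C (c j : F)) * frac φ (D.p j) q (D.m j) := by
  have hψ := hS.sum_ext.injective
  have hmemE : ∀ f : E, ι (ψ f) ∈ level (ι.comp ψ) kindH τ k := fun f =>
    Subring.subset_closure (Or.inl ⟨f, rfl⟩)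
  obtain ⟨c, e', he', hc0, hsum⟩ : ∃ (c : Fin r → constants σF) (e' : H),
      e' ∈ level (ι.comp ψ) kindH τ k ∧ (h ∈ level (ι.comp ψ) kindH τ k → c = 0) ∧
      h = ∑ j, ι (ψ (φ (RatFunc.C (c j : F))) * s j) + e' := by
    -- If `h` is already free of the contributions, the trivial decomposition is chosen, which
    -- secures `c = 0`.
    by_cases hmem : h ∈ level (ι.comp ψ) kindH τ k
    · exact ⟨0, h, hmem, fun _ => rfl, by simp⟩
    have hstab : ShiftStable σH ι ψ.range kindH τ :=
      shiftStable_of_isXDegExtension hS.base_ext.admissible hH (containsXDegLE_top d)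
        fun f _ => ⟨f, rfl⟩
    have hconst : ∀ c, σH c = c → ∃ a : constants σF, ι (ψ (φ (RatFunc.C (a : F)))) = c := by
      intro c hc
      obtain ⟨b, hb, rfl⟩ := hH.ext.map_of_const hc
      obtain ⟨a, rfl⟩ := hS.exists_of_const hF hb
      exact ⟨a, rfl⟩
    obtain ⟨c, hc, e', he', heq⟩ := exists_linear_of_shift_sub_mem hS.sum_ext
      (fun j => ⟨_, (hS.shift_eq j).symm⟩) hH.ext hstab
      (eq_zero_of_natCast_mul_eq_zero (((ι.comp ψ).comp φ).comp RatFunc.C))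
      (fun c hc => by
        obtain ⟨a, rfl⟩ := hconst c hc
        exact hmemE _) (h := h) (by rw [hh]; exact hmemE _)
    choose a ha using fun j => hconst (c j) (hc j)
    refine ⟨a, e', he', fun h => absurd h hmem, ?_⟩
    rw [heq]
    simp [ha]
  refine ⟨c, e', he', hc0, hsum, ?_⟩
  -- What is left at `q` in the equation for `e' - ι (ψ g)` after the differences of the `cⱼ sⱼ` are
  -- subtracted.
  set Y : F[X] → E := fun q => frac φ (p q) q (n q) - ∑ j : D.Idx q,
    φ (RatFunc.C (c j : F)) * frac φ (D.p j) q (D.m j) with hYdef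
  have hY := eq_zero_of_shift_sub_eq hF hS.base_ext hS.base_deg hψ hS.sum_ext.extends_base hH hQt
    (Y := Y) (fun q hq => by
      refine AddSubgroup.sub_mem _ (frac_mem_normalForms _ (hp q hq))
        (AddSubgroup.sum_mem _ fun j _ => C_mul_mem_normalForms _ (frac_mem_normalForms _ ?_))
      have := hS.numerator j
      rwa [j.2] at this) hρ (G := e' - ι (ψ g)) (Subring.sub_mem _ he' (hmemE g)) (by
      have h1 : ∑ q ∈ Qt, ∑ j : D.Idx q, φ (RatFunc.C (c j : F)) * frac φ (D.p j) q (D.m j) =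
          ∑ j, φ (RatFunc.C (c j : F)) * frac φ (D.p j) (D.q j) (D.m j) := by
        rw [← Finset.sum_fiberwise_of_maps_to (s := Finset.univ) (t := Qt) (g := D.q)
          (fun j _ => hQ (hS.mem j))]
        refine Finset.sum_congr rfl fun q _ => ?_
        rw [← Finset.sum_subtype_eq_sum_filter, Finset.subtype_univ]
        refine Finset.sum_congr rfl fun j _ => ?_
        rw [j.2]
      have h2 : σH (∑ j, ι (ψ (φ (RatFunc.C (c j : F))) * s j)) -
          ∑ j, ι (ψ (φ (RatFunc.C (c j : F))) * s j) =
          ι (ψ (∑ j, φ (RatFunc.C (c j : F)) * frac φ (D.p j) (D.q j) (D.m j))) := by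
        rw [map_sum, map_sum, map_sum, ← Finset.sum_sub_distrib]
        refine Finset.sum_congr rfl fun j _ => ?_
        rw [hH.ext.extends_base, map_mul σS, hS.sum_ext.extends_base, map_const hF hS.base_ext,
          map_mul ψ, ← hS.shift_eq, ← map_sub, mul_sub]
      rw [hsum, map_add] at hh
      simp only [hYdef, Finset.sum_sub_distrib, h1]
      rw [map_sub, hH.ext.extends_base, hS.sum_ext.extends_base]
      simp only [map_sub, map_add] at hh h2 ⊢
      linear_combination hh - h2)
  intro q hq
  exact sub_eq_zero.1 (hY q hq)

end Decomposition

/-! ### Denominators and degree bounds in a longer tower -/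

section Transfer

variable {F : Type u} [Field F] {σ : RatFunc F ≃+* RatFunc F} {d : ℕ}
  {E : Type v} [CommRing E] {σE : E ≃+* E} {φ : RatFunc F →+* E}
  {e : ℕ} {kind : Fin e → Kind} {t : Fin e → E}
  {H : Type w} [CommRing H] {σH : H ≃+* H} {χ : E →+* H} {k : ℕ} {kindH : Fin k → Kind}
  {τ : Fin k → H}

/-- The normalized generator of the intersection of the principal ideals; it is nonzero because it
divides the product of the `g i`. -/
theorem exists_isMonicLcm {ι : Type*} (s : Finset ι) {g : ι → F[X]} (hg : ∀ i ∈ s, g i ≠ 0) :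
    ∃ b, IsMonicLcm s g b := by
  classical
  set I : Ideal F[X] := ⨅ i ∈ s, Ideal.span {g i} with hI
  have hmem : ∀ a, a ∈ I ↔ ∀ i ∈ s, g i ∣ a := fun a => by
    simp [hI, Submodule.mem_iInf, Ideal.mem_span_singleton]
  obtain ⟨b, hb⟩ := (IsPrincipalIdealRing.principal I).principal
  have hb' : ∀ a, b ∣ a ↔ ∀ i ∈ s, g i ∣ a := fun a => by
    rw [← hmem, hb]
    exact Ideal.mem_span_singleton.symm
  have h0 : b ≠ 0 := by
    intro h
    have := (hb' (∏ i ∈ s, g i)).2 fun i hi => Finset.dvd_prod_of_mem g hi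
    rw [h, zero_dvd_iff] at this
    exact Finset.prod_ne_zero_iff.2 hg this
  refine ⟨normalize b, monic_normalize h0, fun a => ?_⟩
  rw [normalize_dvd_iff, hb']

/-- The denominators of the coefficients `a / q` divide `q`, hence so does their least common
multiple. -/
theorem exists_isDen_frac {p : E} (hp : IsPolyElt φ kind t p) {q : F[X]}
    (hqd : PolyXDegLE σ d q) : ∃ b, IsDen φ kind t (frac φ p q 1) b ∧ PolyXDegLE σ d b := by
  obtain ⟨c, hc, rfl⟩ := hp
  set c' : (Fin e → ℤ) →₀ RatFunc F := c.mapRange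
    (fun a => algebraMap F[X] (RatFunc F) a / algebraMap F[X] (RatFunc F) q) (by simp) with hc'
  obtain ⟨b, hb⟩ := exists_isMonicLcm c'.support (g := fun n => (c' n).denom)
    (fun n _ => RatFunc.denom_ne_zero _)
  refine ⟨b, ⟨c', ⟨fun n hn => hc n (Finsupp.support_mapRange hn), ?_⟩, hb⟩, fun h hh hhb => ?_⟩
  · rw [Finsupp.sum_mapRange_index (by simp), frac, Finsupp.mul_sum]
    refine Finset.sum_congr rfl fun n _ => ?_
    beta_reduce
    rw [RingHom.comp_apply, ← mul_assoc, ← map_mul, pow_one, div_eq_inv_mul]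
  · refine hqd h hh (hhb.trans ((hb.2 q).2 fun n _ => ?_))
    beta_reduce
    rw [hc', Finsupp.mapRange_apply]
    exact RatFunc.denom_div_dvd _ _

theorem isReducedExp_append {n : Fin e → ℤ} (hn : IsReducedExp kind n)
    (hτ : Admissible kindH τ) : IsReducedExp (Fin.append kind kindH) (Fin.append n 0) := by
  have h0 := isReducedExp_zero hτ
  rw [isReducedExp_iff] at hn h0 ⊢
  intro j
  refine Fin.addCases (fun j => ?_) (fun j => ?_) j
  · simpa using hn j
  · simpa using h0 j

theorem tpow_append_zero {m : Fin e → ℤ} (hm : ∀ j, 0 ≤ m j ∨ IsUnit (t j)) :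
    tpow (Fin.append (fun j => χ (t j)) τ) (Fin.append m 0) = χ (tpow t m) := by
  rw [tpow_append, map_tpow χ t m hm]
  simp only [Fin.append_left, Fin.append_right]
  change _ * tpow τ 0 = _
  rw [tpow_zero, mul_one]

theorem IsDen.append (ht : Admissible kind t) (hτ : Admissible kindH τ) {f : E} {b : F[X]}
    (h : IsDen φ kind t f b) :
    IsDen (χ.comp φ) (Fin.append kind kindH) (Fin.append (fun j => χ (t j)) τ) (χ f) b := by
  obtain ⟨c, ⟨hc, rfl⟩, hb, hlcm⟩ := h
  set A : (Fin e → ℤ) ↪ (Fin (e + k) → ℤ) := ⟨fun n => Fin.append n 0, fun n m hnm => by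
    ext j
    simpa using congrFun hnm (Fin.castAdd k j)⟩ with hA
  refine ⟨c.embDomain A, ⟨fun n hn => ?_, ?_⟩, hb, fun a => ?_⟩
  · rw [Finsupp.support_embDomain, Finset.mem_map] at hn
    obtain ⟨m, hm, rfl⟩ := hn
    exact isReducedExp_append (hc m hm) hτ
  · rw [Finsupp.sum_embDomain, map_finsuppSum]
    refine Finset.sum_congr rfl fun n hn => ?_
    beta_reduce
    rw [map_mul]
    change _ = _ * tpow _ (Fin.append n 0)
    rw [tpow_append_zero ((hc n hn).nonneg_or_isUnit ht)]
    rfl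
  · rw [hlcm, Finsupp.support_embDomain]
    simp

/-- Only Σ-monomials are appended, so all old conditions persist with exponent vectors extended by
zeros. -/
theorem HasXDegLE.append (hdeg : HasXDegLE σ σE φ d kind t) (ht : Admissible kind t)
    (hτ : Admissible kindH τ) (hχ : ∀ a, σH (χ a) = χ (σE a)) (hkind : ∀ i, kindH i = Kind.sum)
    (hden : ∀ i, ∃ y b, IsDen φ kind t y b ∧ PolyXDegLE σ d b ∧ σH (τ i) - τ i = χ y) :
    HasXDegLE σ σH (χ.comp φ) d (Fin.append kind kindH) (Fin.append (fun j => χ (t j)) τ) := by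
  have hlift : ∀ (i : Fin e) (m : Fin e → ℤ) (a : RatFunc F), (∀ j, m j ≠ 0 → kind j ≠ Kind.sum) →
      σE (t i) = φ a * tpow t m * t i →
      σH (Fin.append (fun j => χ (t j)) τ (Fin.castAdd k i)) =
        (χ.comp φ) a * tpow (Fin.append (fun j => χ (t j)) τ) (Fin.append m 0) *
          Fin.append (fun j => χ (t j)) τ (Fin.castAdd k i) := by
    intro i m a hm h
    rw [tpow_append_zero fun j => ?_, Fin.append_left, hχ, h]
    · simp
    · by_cases hj : m j = 0
      · exact Or.inl hj.ge
      · exact Or.inr (ht.isUnit j (hm j hj))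
  have hsupp : ∀ (i : Fin e) (m : Fin e → ℤ) (p : Kind → Prop),
      (∀ j, m j ≠ 0 → j < i ∧ p (kind j)) → ∀ j, (Fin.append m 0 : Fin (e + k) → ℤ) j ≠ 0 →
        j < Fin.castAdd k i ∧ p (Fin.append kind kindH j) := by
    intro i m p h j
    refine Fin.addCases (fun j hj => ?_) (fun j hj => ?_) j
    · rw [Fin.append_left] at hj ⊢
      exact h j hj
    · rw [Fin.append_right] at hj
      exact absurd rfl hj
  refine ⟨⟨fun i ν => ?_, fun i => ?_⟩, fun i => ?_, fun i => ?_⟩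
  · refine Fin.addCases (fun i hi => ?_) (fun i hi => ?_) i
    · rw [Fin.append_left] at hi
      obtain ⟨a, m, ha, hm, hσ⟩ := hdeg.simple.root i ν hi
      refine ⟨a, Fin.append m 0, ha, hsupp i m (fun κ => ∃ ν', κ = Kind.rootOfUnity ν') hm,
        hlift i m a (fun j hj => ?_) hσ⟩
      obtain ⟨ν', hν'⟩ := (hm j hj).2
      simp [hν']
    · simp [hkind] at hi
  · refine Fin.addCases (fun i hi => ?_) (fun i hi => ?_) i
    · rw [Fin.append_left] at hi
      obtain ⟨a, m, ha, hm, hσ⟩ := hdeg.simple.prod i hi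
      exact ⟨a, Fin.append m 0, ha, hsupp i m (· ≠ Kind.sum) hm,
        hlift i m a (fun j hj => (hm j hj).2) hσ⟩
    · simp [hkind] at hi
  · refine Fin.addCases (fun i hi => ?_) (fun i hi => ?_) i
    · rw [Fin.append_left] at hi
      obtain ⟨a, m, ha, ha', hm, hσ⟩ := hdeg.prod i hi
      exact ⟨a, Fin.append m 0, ha, ha', hsupp i m (· ≠ Kind.sum) hm,
        hlift i m a (fun j hj => (hm j hj).2) hσ⟩
    · simp [hkind] at hi
  · refine Fin.addCases (fun i hi => ?_) (fun i hi => ?_) i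
    · rw [Fin.append_left] at hi
      obtain ⟨b, hb, hbd⟩ := hdeg.sum i hi
      refine ⟨b, ?_, hbd⟩
      rw [Fin.append_left, hχ, ← map_sub]
      exact hb.append ht hτ
    · obtain ⟨y, b, hb, hbd, hy⟩ := hden i
      refine ⟨b, ?_, hbd⟩
      rw [Fin.append_right, hy]
      exact hb.append ht hτ

end Transfer

/-! ### The loop of the algorithm -/

section Loop

variable {F : Type u} [Field F] {σF : F ≃+* F} {E : Type v} [CommRing E] {σE : E ≃+* E}
  {φ : RatFunc F →+* E} {S : Type w} [CommRing S] {σS : S ≃+* S} {ψ : E →+* S}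
  {r : ℕ} {s : Fin r → S} {D : QData F E r}

theorem map_pow_mul_frac {q : F[X]} (hq : q ≠ 0) (p : E) {n m : ℕ} (h : n ≤ m) :
    φ (algebraMap F[X] (RatFunc F) q ^ m) * frac φ p q n =
      φ (algebraMap F[X] (RatFunc F) q ^ (m - n)) * p := by
  rw [frac_eq, ← mul_assoc, ← map_mul, ← Nat.sub_add_cancel h, pow_add, mul_assoc,
    mul_inv_cancel₀ (pow_ne_zero n (algebraMap_polynomial_ne_zero hq)), mul_one,
    Nat.sub_add_cancel h]

theorem eq_of_map_pow_mul_eq {q : F[X]} (hq : q ≠ 0) {m : ℕ} {x y : E}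
    (h : φ (algebraMap F[X] (RatFunc F) q ^ m) * x = φ (algebraMap F[X] (RatFunc F) q ^ m) * y) :
    x = y := by
  have h1 : φ ((algebraMap F[X] (RatFunc F) q ^ m)⁻¹) *
      φ (algebraMap F[X] (RatFunc F) q ^ m) = 1 := by
    rw [← map_mul, inv_mul_cancel₀ (pow_ne_zero m (algebraMap_polynomial_ne_zero hq)), map_one]
  rw [← one_mul x, ← one_mul y, ← h1, mul_assoc, h, ← mul_assoc]

theorem frac_eq_zero_iff {q : F[X]} (hq : q ≠ 0) {p : E} {n : ℕ} :
    frac φ p q n = 0 ↔ p = 0 := by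
  refine ⟨fun h => ?_, fun h => by rw [h, frac_eq, mul_zero]⟩
  have := map_pow_mul_frac (φ := φ) hq p (le_refl n)
  rwa [h, mul_zero, Nat.sub_self, pow_zero, map_one, one_mul, eq_comm] at this

open Classical in
-- Up to the common factor `q ^ μ`, invertible in `E`, the family consists of the fractions
-- themselves. A relation with last entry `-1` expresses the new fraction by the available ones.
theorem mem_relations_iff {q : F[X]} (hq : q ≠ 0) {n : ℕ} {p : E}
    {c : Option (D.Idx q) → constants σF} (hc : c none = -1) :
    c ∈ D.relations σF φ q n p ↔
      frac φ p q n = ∑ j : D.Idx q, φ (RatFunc.C (c (some j) : F)) *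
        frac φ (D.p j) q (D.m j) := by
  have hfam : ∀ i, D.family φ q n p i = φ (algebraMap F[X] (RatFunc F) q ^ D.maxExp q n) *
      (match i with
        | none => frac φ p q n
        | some j => frac φ (D.p j) q (D.m j)) := by
    rintro (_ | j)
    · exact (map_pow_mul_frac hq p (le_max_left _ _)).symm
    · refine (map_pow_mul_frac hq _ (le_trans ?_ (le_max_right _ _))).symm
      exact Finset.le_sup (f := fun k : D.Idx q => D.m k) (Finset.mem_univ j)
  change ∑ i, φ (RatFunc.C (c i : F)) * D.family φ q n p i = 0 ↔ _
  simp only [hfam, mul_left_comm _ (φ (algebraMap F[X] (RatFunc F) q ^ D.maxExp q n))]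
  rw [← Finset.mul_sum, Fintype.sum_option, hc]
  have h1 : φ (RatFunc.C (((-1 : constants σF) : F))) = -1 := by simp
  rw [h1]
  constructor
  · intro h
    rw [← mul_zero (φ (algebraMap F[X] (RatFunc F) q ^ D.maxExp q n))] at h
    have := eq_of_map_pow_mul_eq hq h
    linear_combination -this
  · intro h
    rw [← h]
    ring

/-- `hrel` rules out the branch that adjoins a variable, so only `w` changes. In the remaining
branch the relation makes the added combination of the `sⱼ` telescope the current fraction. -/
theorem LoopRun.exists_w (hF : ∀ a : constants σF, σS (ψ (φ (RatFunc.C (a : F)))) =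
      ψ (φ (RatFunc.C (a : F))))
    (hs : ∀ j, σS (s j) - s j = ψ (frac φ (D.p j) (D.q j) (D.m j)))
    {p : F[X] → E} {n : F[X] → ℕ} {l : List F[X]} {T T' : AlgState F S}
    (hrun : LoopRun σF φ ψ s D p n l T T') (hT : ∀ a, T.ext.σ (T.ext.emb a) = T.ext.emb (σS a))
    (hl : ∀ q ∈ l, q ≠ 0) (hrel : ∀ q ∈ l, p q ≠ 0 →
      Nonempty (D.Idx q) ∧ D.relations σF φ q (n q) (p q) ≠ ⊥) :
    ∃ w, T' = ⟨T.ext, T.Q, w⟩ ∧ T.ext.σ w - w = T.ext.σ T.w - T.w +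
      T.ext.emb (ψ (l.map fun q => frac φ (p q) q (n q)).sum) ∧
      ((∀ q ∈ l, p q = 0) → w = T.w) := by
  classical
  induction hrun with
  | done T => exact ⟨T.w, rfl, by simp, fun _ => rfl⟩
  | skip q l T T' hp _ ih =>
    obtain ⟨w, h1, h2, h3⟩ := ih hT (fun q hq => hl q (List.mem_cons_of_mem _ hq))
      (fun q hq => hrel q (List.mem_cons_of_mem _ hq))
    refine ⟨w, h1, ?_, fun h => h3 fun q hq => h q (List.mem_cons_of_mem _ hq)⟩
    rw [List.map_cons, List.sum_cons, (frac_eq_zero_iff (hl q List.mem_cons_self)).2 hp, zero_add,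
      h2]
  | adjoin q l T T' hp hB _ _ =>
    obtain ⟨h1, h2⟩ := hrel q List.mem_cons_self hp
    exact absurd hB (not_or.2 ⟨not_isEmpty_iff.2 h1, h2⟩)
  | combine q l T T' hp _ c hB hc _ ih =>
    -- The induction hypothesis is restated over `T`, whose ring is that of `T.addW` by definition.
    obtain ⟨w, h1, h2⟩ : ∃ w : T.ext.R, T' = ⟨T.ext, T.Q, w⟩ ∧ T.ext.σ w - w =
        T.ext.σ (T.w + ∑ j : D.Idx q, T.ext.emb (ψ (φ (RatFunc.C (c (some j) : F))) * s j)) -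
        (T.w + ∑ j : D.Idx q, T.ext.emb (ψ (φ (RatFunc.C (c (some j) : F))) * s j)) +
        T.ext.emb (ψ (l.map fun q => frac φ (p q) q (n q)).sum) := by
      obtain ⟨w, h1, h2, -⟩ := ih hT (fun q hq => hl q (List.mem_cons_of_mem _ hq))
        (fun q hq => hrel q (List.mem_cons_of_mem _ hq))
      exact ⟨w, h1, h2⟩
    refine ⟨w, h1, ?_, fun h => absurd (h q List.mem_cons_self) hp⟩
    have hmem : c ∈ D.relations σF φ q (n q) (p q) := by
      rw [hB]
      exact Submodule.mem_span_singleton_self c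
    rw [mem_relations_iff (hl q List.mem_cons_self) hc] at hmem
    have hstep : ∑ j : D.Idx q, σS (ψ (φ (RatFunc.C (c (some j) : F))) * s j) -
        ∑ j : D.Idx q, ψ (φ (RatFunc.C (c (some j) : F))) * s j =
        ψ (frac φ (p q) q (n q)) := by
      rw [hmem, map_sum, ← Finset.sum_sub_distrib]
      refine Finset.sum_congr rfl fun j _ => ?_
      have := hs j
      rw [j.2] at this
      rw [map_mul, hF, map_mul, ← this, mul_sub]
    have h4 := congrArg T.ext.emb hstep
    rw [map_sub, map_sum, map_sum] at h4
    rw [h2, map_add, map_sum, List.map_cons, List.sum_cons, map_add, map_add, ← h4]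
    simp only [hT]
    ring

end Loop

/-! ### Adjoining the final variable -/

section Adjunction

variable {F : Type u} [Field F] {σF : F ≃+* F} {σ : RatFunc F ≃+* RatFunc F} {d : ℕ}
  {E : Type v} [CommRing E] {σE : E ≃+* E} {φ : RatFunc F →+* E}
  {e : ℕ} {kind : Fin e → Kind} {t : Fin e → E} {Q : Finset F[X]}
  {S : Type w} [CommRing S] {σS : S ≃+* S} {ψ : E →+* S}
  {r : ℕ} {s : Fin r → S} {D : QData F E r}

theorem IsRPSExtension.refl (σS : S ≃+* S) :
    IsRPSExtension σS σS (RingHom.id S) (fun _ : Fin 0 => Kind.sum) Fin.elim0 where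
  injective := Function.injective_id
  extends_base _ := rfl
  monomial i := i.elim0
  generate := by
    rw [level_zero_eq_range]
    exact RingHom.range_eq_top.2 Function.surjective_id
  const c _ := ⟨c, rfl⟩

theorem admissible_sum {k : ℕ} (τ : Fin k → S) : Admissible (fun _ : Fin k => Kind.sum) τ :=
  ⟨fun _ _ h => (by cases h), fun _ h => (by cases h)⟩

/-- Makes the results about `H` available for `S` itself. -/
theorem IsQReduced.isXDegExtension_refl (hS : IsQReduced σ σE φ d kind t Q σS ψ s D) :
    IsXDegExtension σ φ d kind t σS ψ σS (RingHom.id S) (fun _ : Fin 0 => Kind.sum)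
      Fin.elim0 where
  ext := IsRPSExtension.refl σS
  deg := hS.base_deg.append hS.base_ext.admissible (admissible_sum _) hS.sum_ext.extends_base
    (fun i => i.elim0) (fun i => i.elim0)

/-- `ε` and `τ` are given by equations only, so that the embedding and the generators of
`DiffExt.adjoin` fit without unfolding. -/
theorem isRPSExtension_polyShift {β : S} (h : ∀ p : S[X], polyShift σS β p = p →
    ∃ a, σS a = a ∧ C a = p) {ε : S →+* S[X]} (hε : ∀ a, ε a = C a) {τ : Fin 1 → S[X]}
    (hτ : ∀ i, τ i = X) :
    IsRPSExtension σS (polyShift σS β) ε (fun _ => Kind.sum) τ where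
  injective a b hab := C_injective (by rw [← hε, hab, hε])
  extends_base a := by rw [hε, hε, polyShift_C]
  monomial i := by
    have hi : ((i : Fin 1) : ℕ) = 0 := by omega
    rw [hi, level_zero_eq_range, hτ]
    constructor
    · rw [transcendental_iff]
      intro p hp
      choose a ha using fun n => (p.coeff n).2
      simp only [hε] at ha
      rw [aeval_eq_sum_range] at hp
      ext n
      have h1 := congrArg (fun f : S[X] => f.coeff n) hp
      simp only [finsetSum_coeff, Subring.smul_def, ← ha, smul_eq_mul, coeff_C_mul, coeff_X_pow,
        coeff_zero, mul_ite, mul_one, mul_zero, Finset.sum_ite_eq] at h1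
      by_cases hn : n ∈ Finset.range (p.natDegree + 1)
      · rw [if_pos hn] at h1
        rw [← ha, h1]
        simp
      · have hlt : p.natDegree < n := by simpa using hn
        rw [coeff_eq_zero_of_natDegree_lt hlt]
        simp
    · refine ⟨β, ?_⟩
      rw [polyShift_X, add_sub_cancel_left]
      exact hε β
  generate := by
    rw [eq_top_iff]
    intro p _
    have hX : X ∈ level ε (fun _ => Kind.sum) τ 1 :=
      Subring.subset_closure (Or.inr ⟨0, Nat.lt_succ_self 0, Or.inl (hτ 0).symm⟩)
    have hC : ∀ a, C a ∈ level ε (fun _ => Kind.sum) τ 1 :=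
      fun a => Subring.subset_closure (Or.inl ⟨a, hε a⟩)
    induction p using Polynomial.induction_on' with
    | add p q hp hq => exact Subring.add_mem _ (hp trivial) (hq trivial)
    | monomial n a =>
      rw [← C_mul_X_pow_eq_monomial]
      exact Subring.mul_mem _ (hC a) (Subring.pow_mem _ hX n)
  const c hc := by
    obtain ⟨a, _, ha⟩ := h c hc
    exact ⟨a, by rw [hε, ha]⟩

theorem IsQReduced.exists_inverse_of_const [CharZero F] (hF : IsPiSigmaFieldExt σF σ)
    (hS : IsQReduced σ σE φ d kind t Q σS ψ s D) {c : S} (hc : σS c = c) (h0 : c ≠ 0) {m : ℕ}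
    (hm : m ≠ 0) : ∃ c', σS c' = c' ∧ m * c * c' = 1 := by
  obtain ⟨a, rfl⟩ := hS.exists_of_const hF hc
  have ha : (a : F) ≠ 0 := fun h => h0 (by rw [h]; simp)
  have hσa : σF (a : F) = a := a.2
  refine ⟨ψ (φ (RatFunc.C ((m * (a : F))⁻¹))), ?_, ?_⟩
  · rw [hS.sum_ext.extends_base, hS.base_ext.extends_base, hF.extends_base, map_inv₀ σF, map_mul,
      map_natCast, hσa]
  · have h1 : (m : S) = ψ (φ (RatFunc.C (m : F))) := by simp
    rw [h1, ← map_mul, ← map_mul, ← map_mul, ← map_mul, ← map_mul, ← map_mul,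
      mul_inv_cancel₀ (mul_ne_zero (Nat.cast_ne_zero.2 hm) ha)]
    simp

theorem IsQReduced.isXDegExtension_polyShift [CharZero F] (hF : IsPiSigmaFieldExt σF σ)
    (hS : IsQReduced σ σE φ d kind t Q σS ψ s D) {ρ : E} {b : F[X]} (hρ : IsDen φ kind t ρ b)
    (hb : PolyXDegLE σ d b) (hγ : ¬ ∃ γ, σS γ - γ = ψ ρ) {ε : S →+* S[X]} (hε : ∀ a, ε a = C a)
    {τ : Fin 1 → S[X]} (hτ : ∀ i, τ i = X) :
    IsXDegExtension σ φ d kind t σS ψ (polyShift σS (ψ ρ)) ε (fun _ => Kind.sum) τ where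
  ext := isRPSExtension_polyShift (fun _ hp => eq_C_of_polyShift_eq
    (fun _ hc h0 _ hm => hS.exists_inverse_of_const hF hc h0 hm) hγ hp) hε hτ
  deg := by
    refine HasXDegLE.append (χ := ε.comp ψ) hS.base_deg
      hS.base_ext.admissible (admissible_sum _) (fun a => ?_) (fun i => rfl)
      fun i => ⟨ρ, b, hρ, hb, ?_⟩
    · rw [RingHom.comp_apply, RingHom.comp_apply, hε, hε, polyShift_C, hS.sum_ext.extends_base]
    · rw [hτ, polyShift_X, add_sub_cancel_left, RingHom.comp_apply, hε]

/-- If the telescoping equation of an element in `σ`-reduced form has a solution in `S`, then the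
one of its part of bounded `x`-degree has a solution in `E`. -/
theorem IsQReduced.exists_of_exists [CharZero F] (hF : IsPiSigmaFieldExt σF σ)
    (hS : IsQReduced σ σE φ d kind t Q σS ψ s D) {Qt : Finset F[X]} (hQt : IsDXSet σ d Qt)
    (hQ : Q ⊆ Qt) {g ρ : E} {p : F[X] → E} {n : F[X] → ℕ}
    (hp : ∀ q ∈ Qt, IsPolyEltDegLT φ kind t (p q) (n q * q.natDegree))
    (hρ : ∀ O, ContainsXDegLE σ d O → ρ ∈ levelOver φ O kind t e) {h : S}
    (hh : σS h - h = ψ (σE g - g + ((∑ q ∈ Qt, frac φ (p q) q (n q)) + ρ))) :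
    ∃ γ : E, σE γ - γ = ρ := by
  classical
  obtain ⟨c, e', he', -, hsum, hfrac⟩ := exists_decomposition hF hS hS.isXDegExtension_refl hQt hQ
    hp hρ hh
  rw [level_zero_eq_range] at he'
  obtain ⟨a, rfl⟩ := he'
  -- In `h = ∑ cⱼ sⱼ + ψ a` the sum accounts for the fractions at the `q`, and `g` for `σ(g) - g`;
  -- so `a - g` is left for `ρ`.
  refine ⟨a - g, hS.sum_ext.injective ?_⟩
  have h1 : ∑ q ∈ Qt, frac φ (p q) q (n q) =
      ∑ j, φ (RatFunc.C (c j : F)) * frac φ (D.p j) (D.q j) (D.m j) := by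
    rw [← Finset.sum_fiberwise_of_maps_to (s := Finset.univ) (t := Qt) (g := D.q)
      (fun j _ => hQ (hS.mem j))]
    refine Finset.sum_congr rfl fun q hq => ?_
    rw [hfrac q hq, ← Finset.sum_subtype_eq_sum_filter, Finset.subtype_univ]
    refine Finset.sum_congr rfl fun j _ => ?_
    rw [j.2]
  have h2 : σS (∑ j, ψ (φ (RatFunc.C (c j : F))) * s j) -
      ∑ j, ψ (φ (RatFunc.C (c j : F))) * s j =
      ψ (∑ j, φ (RatFunc.C (c j : F)) * frac φ (D.p j) (D.q j) (D.m j)) := by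
    rw [map_sum, map_sum, ← Finset.sum_sub_distrib]
    refine Finset.sum_congr rfl fun j _ => ?_
    rw [map_mul σS, hS.sum_ext.extends_base, map_const hF hS.base_ext, map_mul ψ, ← hS.shift_eq,
      mul_sub]
  simp only [RingHom.id_apply, RingHom.comp_apply] at hsum
  rw [hsum, h1, map_add σS, hS.sum_ext.extends_base] at hh
  simp only [map_sub, map_add] at hh h2 ⊢
  linear_combination hh - h2

end Adjunction

end Telescoping

end

/-! ### Proof of the corollary -/

open Telescoping

theorem mainTheorem6
    {F : Type*} [Field F] [CharZero F] (σF : F ≃+* F) (σ : RatFunc F ≃+* RatFunc F)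
    (hF : Telescoping.IsPiSigmaFieldExt σF σ) (d : ℕ)
    {E : Type*} [CommRing E] (σE : E ≃+* E) (φ : RatFunc F →+* E)
    {e : ℕ} (kind : Fin e → Telescoping.Kind) (t : Fin e → E)
    (Q : Finset (Polynomial F))
    {S : Type*} [CommRing S] (σS : S ≃+* S) (ψ : E →+* S)
    {r : ℕ} (s : Fin r → S) (D : Telescoping.QData F E r)
    (hS : Telescoping.IsQReduced σ σE φ d kind t Q σS ψ s D)
    (f : E) (out : Telescoping.AlgOutput F S)
    (hout : Telescoping.IsAlgOutput σF σ σE φ d kind t Q σS ψ s D f out)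
    {H : Type*} [CommRing H] (σH : H ≃+* H) (ι : S →+* H)
    {k : ℕ} (kindH : Fin k → Telescoping.Kind) (τ : Fin k → H)
    (hH : Telescoping.IsXDegExtension σ φ d kind t σS ψ σH ι kindH τ)
    (h' : H) (hh' : σH h' - h' = ι (ψ f)) :
    out.ext.σ out.h - out.h = out.ext.emb (ψ f) ∧
    (out.Q = Q ∧
      Telescoping.IsXDegExtension σ φ d kind t σS ψ out.ext.σ out.ext.emb
        (fun _ => Telescoping.Kind.sum) out.ext.gen) ∧
    (Function.Bijective ι → Function.Bijective out.ext.emb) ∧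
    (h' ∈ Telescoping.level (ι.comp ψ) kindH τ k →
      out.h ∈ Telescoping.level (out.ext.emb.comp ψ) (fun _ => Telescoping.Kind.sum)
        out.ext.gen out.ext.n) := by
  classical
  obtain ⟨Qt, _, g, p, n, p₀, q₀, l, T, hQ, -, hQt, hf, -, hq₀, hq₀d, hp₀, hp, hnodup, hl, hrun,
    hfin⟩ := hout
  have hdx := hQt.1
  set ρ := frac φ p₀ q₀ 1 with hρdef
  have hρ : ∀ O, ContainsXDegLE σ d O → ρ ∈ levelOver φ O kind t e := fun O hO =>
    frac_mem_levelOver hS.base_ext.admissible hp₀ hq₀d hO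
  obtain ⟨c, e', he', hc0, hsum, hfrac⟩ := exists_decomposition hF hS hH hdx hQ hp hρ
    (hh'.trans (by rw [hf]))
  have hσC : ∀ a : constants σF, σS (ψ (φ (RatFunc.C (a : F)))) = ψ (φ (RatFunc.C (a : F))) :=
    fun a => by rw [hS.sum_ext.extends_base, map_const hF hS.base_ext]
  have hrel : ∀ q ∈ l, p q ≠ 0 →
      Nonempty (D.Idx q) ∧ D.relations σF φ q (n q) (p q) ≠ ⊥ := by
    intro q hq hpq
    have hq := (hl q).1 hq
    have hq0 := (hdx.irreducible q hq).ne_zero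
    have h1 := hfrac q hq
    refine ⟨?_, fun hbot => ?_⟩
    · by_contra hemp
      rw [not_nonempty_iff] at hemp
      rw [Finset.univ_eq_empty, Finset.sum_empty] at h1
      exact hpq ((frac_eq_zero_iff hq0).1 h1)
    -- The decomposition of `h'` supplies a relation with last entry `-1`, so the relation space is
    -- nonzero.
    · have h2 := (mem_relations_iff (D := D) (σF := σF) hq0 (c := fun i : Option (D.Idx q) =>
        i.elim (-1) fun j => c j) rfl).2 h1
      rw [hbot, Submodule.mem_bot] at h2
      have h3 := congrFun h2 none
      have h4 : (-1 : F) = 0 := congrArg Subtype.val h3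
      exact one_ne_zero (neg_eq_zero.1 h4)
  have hlsum : (l.map fun q => frac φ (p q) q (n q)).sum = ∑ q ∈ Qt, frac φ (p q) q (n q) := by
    rw [← List.sum_toFinset _ hnodup]
    exact Finset.sum_congr (by ext q; simp [hl]) fun _ _ => rfl
  obtain ⟨w, rfl, hw, hw0⟩ : ∃ w : S, T = ⟨DiffExt.init σS, Q, w⟩ ∧
      σS w - w = ψ (∑ q ∈ Qt, frac φ (p q) q (n q)) ∧
      (h' ∈ level (ι.comp ψ) kindH τ k → w = 0) := by
    obtain ⟨w, h1, h2, h3⟩ : ∃ w : S, T = ⟨DiffExt.init σS, Q, w⟩ ∧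
        σS w - w = σS 0 - 0 + ψ (l.map fun q => frac φ (p q) q (n q)).sum ∧
        ((∀ q ∈ l, p q = 0) → w = 0) := hrun.exists_w hσC hS.shift_eq (fun _ => rfl)
      (fun q hq => (hdx.irreducible q ((hl q).1 hq)).ne_zero) hrel
    rw [hlsum, map_zero, sub_zero, zero_add] at h2
    refine ⟨w, h1, h2, fun hmem => h3 fun q hq => ?_⟩
    have hq := (hl q).1 hq
    -- For a free `h'` all `cⱼ` are zero, hence so is each fraction and its numerator.
    rw [← frac_eq_zero_iff (φ := φ) (hdx.irreducible q hq).ne_zero (n := n q), hfrac q hq,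
      hc0 hmem]
    simp
  cases hfin with
  | solved γ hγ =>
    refine ⟨?_, ⟨rfl, hS.isXDegExtension_refl⟩, fun _ => Function.bijective_id, fun hmem => ?_⟩
    · have h1 : σS (ψ g + ψ γ + w) - (ψ g + ψ γ + w) = ψ f := by
        rw [← hf, ← hγ]
        simp only [map_add, map_sub, hS.sum_ext.extends_base] at hw ⊢
        linear_combination hw
      exact h1
    · have h1 : ψ g + ψ γ + w ∈ level ψ (fun _ => Kind.sum) Fin.elim0 0 := by
        rw [hw0 hmem, level_zero_eq_range, add_zero, ← map_add]
        exact ⟨_, rfl⟩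
      exact h1
  | extend hγ =>
    obtain ⟨b, hb, hbd⟩ := exists_isDen_frac hp₀ hq₀d
    have hgen : ∀ i : Fin 1, ((DiffExt.init σS).adjoin (ψ ρ)).gen i = (X : S[X]) := by
      intro i
      have hi : i = Fin.last 0 := Subsingleton.elim _ _
      rw [hi]
      rfl
    refine ⟨?_, ⟨rfl, hS.isXDegExtension_polyShift hF hb hbd ?_ (fun _ => rfl) hgen⟩,
      fun hbij => ?_, fun hmem => ?_⟩
    · have h1 : polyShift σS (ψ ρ) (C (ψ g) + X + C w) - (C (ψ g) + X + C w) = C (ψ f) := by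
        simp only [map_add, polyShift_C, polyShift_X]
        have h1 := congrArg (C : S → S[X]) hw
        rw [← hf]
        simp only [map_add, map_sub, hS.sum_ext.extends_base] at h1 ⊢
        linear_combination h1
      exact h1
    · rintro ⟨y, hy⟩
      -- With `g` and all numerators zero, the reduced form is `ρ` alone.
      refine hγ (hS.exists_of_exists hF hdx hQ (g := 0) (p := 0) (n := 0) (fun q _ => ?_) hρ
        (h := y) ?_)
      · exact ⟨0, ⟨by simp, by simp⟩, fun _ => by simp⟩
      · rw [hy, ← hρdef]
        simp [frac]
    -- Now `h'` comes from `S`, and the descent to `E` contradicts `hγ`: this case does not occur.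
    · obtain ⟨y, rfl⟩ := hbij.2 h'
      refine absurd (hS.exists_of_exists hF hdx hQ (g := g) hp hρ (h := y) ?_) hγ
      refine hbij.1 ?_
      rw [map_sub, ← hH.ext.extends_base, hh', hf]
    · have h1 : ∀ τ : Fin 1 → S[X], (∀ i, τ i = X) → C (ψ g) + X + C w ∈
          level ((C.comp (RingHom.id S)).comp ψ) (fun _ => Kind.sum) τ 1 := by
        intro τ hτ
        rw [hw0 hmem, map_zero, add_zero]
        exact Subring.add_mem _ (Subring.subset_closure (Or.inl ⟨g, rfl⟩))
          (Subring.subset_closure (Or.inr ⟨0, Nat.lt_succ_self 0, Or.inl (hτ 0).symm⟩))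
      exact h1 _ hgen
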